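/- All graphs are finite and simple. For $\delta\in(0,1)$ a graph $G=(V_G,E_G)$ is called $(1+\delta)$-sparse if for every $S\subseteq V_G$ the number of edges of $G$ with both endpoints in $S$ is at most $(1+\delta)|S|$. For a connected graph $G$, let $\Sigma(G)$ be its one-dimensional simplicial complex, in which every edge is a unit interval, let $d_{\Sigma(G)}$ be the geodesic distance on $\Sigma(G)$, and let $\mathrm{diam}(G)$ be the diameter of $V_G$ in the shortest-path metric. A spanning tree $T$ of $\Sigma(G)$ is obtained from a spanning tree $T_0$ of the graph $G$ as follows: the edges of $T_0$ are included as unit intervals and, for every edge $e=\{u,v\}$ of $G$ that is not an edge of $T_0$, the unit interval of $e$ is partitioned into two connected sets $I_u\ni u$ and $I_v\ni v$, where $I_u$ is glued to $T_0$ at $u$ only and $I_v$ is glued to $T_0$ at $v$ only. Thus $T$ has the same points as $\Sigma(G)$; its geodesic distance is denoted $d_T$. Let $\mathfrak T(\Sigma(G))$ be the set of all spanning trees of $\Sigma(G)$, with the $\sigma$-algebra generated by the functions $T\mapsto d_T(x,y)$, $x,y\in\Sigma(G)$. Finally, $c_1(\Sigma(G))$ is the infimum of those $D\in[1,\infty)$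 for which there are $s\in(0,\infty)$ and $f:\Sigma(G)\to L_1([0,1])$ with $s\,d_{\Sigma(G)}(x,y)\le\|f(x)-f(y)\|_1\le Ds\,d_{\Sigma(G)}(x,y)$ for all $x,y\in\Sigma(G)$. Theorem. There is a universal constant $K\in(0,\infty)$ such that for every $\delta\in(0,1)$ and every connected $(1+\delta)$-sparse graph $G$ (with no assumption on its girth) there is a probability measure $\mu$ on $\mathfrak T(\Sigma(G))$ for which $$\int_{\mathfrak T(\Sigma(G))}\min\{d_T(x,y),\mathrm{diam}(G)\}\,d\mu(T)\le K\bigl(1+\delta\,\mathrm{diam}(G)\bigr)\,d_{\Sigma(G)}(x,y)\qquad\text{for all }x,y\in\Sigma(G),$$ and moreover $$c_1(\Sigma(G))\le K\bigl(1+\delta\,\mathrm{diam}(G)\bigr).$$ -/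

import Mathlib

open MeasureTheory
open scoped ENNReal NNReal

namespace GraphComplex

/-- The gluing (path) extended metric determined by a family `𝒜` of pieces of a metric space:
the infimum of the lengths of all finite chains `x = p 0, p 1, …, p n = y` in which any two
consecutive points lie in a common piece, a step being measured by the ambient metric.
It is `∞` when there is no such chain. -/
noncomputable def chainEDist {E : Type*} [PseudoEMetricSpace E] (𝒜 : Set (Set E)) (x y : E) :
    ℝ≥0∞ :=
  ⨅ (n : ℕ) (p : ℕ → E) (_ : p 0 = x) (_ : p n = y)
    (_ : ∀ i < n, ∃ A ∈ 𝒜, p i ∈ A ∧ p (i + 1) ∈ A),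
    ∑ i ∈ Finset.range n, edist (p i) (p (i + 1))

/-- The distortion `c_Y(X)` of a space `X` with (extended) distance function `d` in a metric
space `Y`; it is `∞` if there is no bi-Lipschitz embedding. -/
noncomputable def distortion {X : Type*} (d : X → X → ℝ≥0∞) (Y : Type*) [EDist Y] : ℝ≥0∞ :=
  ⨅ (D : ℝ≥0) (_ : 1 ≤ D)
    (_ : ∃ s : ℝ≥0, 0 < s ∧ ∃ f : X → Y, ∀ x y : X,
      s * d x y ≤ edist (f x) (f y) ∧ edist (f x) (f y) ≤ D * s * d x y),
    (D : ℝ≥0∞)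

/-- The Banach space `L_1 = L_1([0,1])` of real functions. -/
abbrev L1 : Type := Lp ℝ 1 (volume : Measure unitInterval)

section Sparse

variable {V : Type*}

/-- `E_G(S)`: the edges of `G` both of whose endpoints lie in `S`. -/
def edgesIn (G : SimpleGraph V) (S : Set V) : Set (Sym2 V) :=
  {e | e ∈ G.edgeSet ∧ ∀ v ∈ e, v ∈ S}

/-- `G` is `(1+δ)`-sparse: `|E_G(S)| ≤ (1+δ)|S|` for every (finite) set `S` of vertices. -/
def IsSparse (G : SimpleGraph V) (δ : ℝ) : Prop :=
  ∀ S : Finset V, ((edgesIn G (S : Set V)).ncard : ℝ) ≤ (1 + δ) * (S.card : ℝ)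

end Sparse

section Complex

variable {V : Type*} [Fintype V]

open Classical in
/-- The vertices of the complex are the coordinate basis vectors of `ℝ^V`. -/
noncomputable def vertex (v : V) : V → ℝ := Pi.single v 1

/-- The straight segment in `ℝ^V` joining the vertices `u` and `v`. When `u ≠ v` it has length
one in the sup-distance of `V → ℝ`, the restriction of which to it is the usual distance of a
unit interval. -/
noncomputable def edge (u v : V) : Set (V → ℝ) := segment ℝ (vertex u) (vertex v)

/-- The one-dimensional simplicial complex `Σ(G)` of `G` as a subset of `ℝ^V`: all vertices,
together with a unit interval for each edge of `G`. -/
def complex (G : SimpleGraph V) : Set (V → ℝ) :=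
  {x | (∃ v, x = vertex v) ∨ ∃ u v, G.Adj u v ∧ x ∈ edge u v}

/-- The unit intervals that make up the complex of a graph. -/
def edges (G : SimpleGraph V) : Set (Set (V → ℝ)) :=
  {A | ∃ u v, G.Adj u v ∧ A = edge u v}

/-- The geodesic distance `d_{Σ(G)}`, edges being unit intervals. -/
noncomputable def complexEDist (G : SimpleGraph V) (x y : complex G) : ℝ≥0∞ :=
  chainEDist (edges G) (x : V → ℝ) (y : V → ℝ)

/-- A spanning tree of `Σ(G)`: a spanning tree of `G` and, for each edge `{u,v}` of `G` outside
it, a partition of the corresponding unit interval into two connected sets, `half (u,v)`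
containing `u` and `half (v,u)` containing `v`. The set `half (u,v)` is glued to the
tree at `u` only. (An oriented edge of `G` outside the tree is a dart of `G \ tree`.) -/
structure SpanningTree (G : SimpleGraph V) where
  tree : SimpleGraph V
  tree_le : tree ≤ G
  isTree : tree.IsTree
  half : (G \ tree).Dart → Set (V → ℝ)
  vertex_mem_half : ∀ d, vertex d.fst ∈ half d
  half_connected : ∀ d, IsConnected (half d)
  half_union : ∀ d, half d ∪ half d.symm = edge d.fst d.snd
  half_disjoint : ∀ d, Disjoint (half d) (half d.symm)

namespace SpanningTree

variable {G : SimpleGraph V}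

/-- The intervals that are glued together to form `T`: the edges of the underlying spanning tree
of `G` and the two parts of each of the remaining edges of `G`. -/
def pieces (T : SpanningTree G) : Set (Set (V → ℝ)) :=
  edges T.tree ∪ Set.range T.half

/-- The geodesic distance `d_T` of the spanning tree `T` of `Σ(G)`, on the points of `Σ(G)`. -/
protected noncomputable def edist (T : SpanningTree G) (x y : complex G) : ℝ≥0∞ :=
  chainEDist T.pieces (x : V → ℝ) (y : V → ℝ)

/-- The set of spanning trees of `Σ(G)` carries the σ-algebra generated by the functions
`T ↦ d_T(x,y)` for `x, y ∈ Σ(G)`. -/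
noncomputable instance instMeasurableSpace : MeasurableSpace (SpanningTree G) :=
  ⨆ (x : complex G) (y : complex G),
    MeasurableSpace.comap (fun T : SpanningTree G => T.edist x y) inferInstance

end SpanningTree

end Complex

end GraphComplex

/-! Everything is reduced to a random spanning tree of the graph, with `N = diam + 1`, in which each
edge `uv` of `G` has expected truncated tree distance `E min(d_T(u,v), N)` at most `2 + 2δN`. By
minimax duality (`exists_convex_weights_of_forall_exists_le`) it suffices to find, for every
nonnegative weight on the edges, one tree whose weighted average is that small. The maximum-weight
tree of the greedy algorithm works: it spans every component of every superlevel graph of the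
weight, so a layer-cake summation reduces the claim to the unweighted average over one component.
There sparsity applies: a component with one non-tree edge is unicyclic and that edge costs no more
than the number of tree edges, while with at least two non-tree edges these make up at most a `2δ`
proportion of all edges and each costs at most `N`.

A single uniform threshold, used on all edges at once, cuts the unit intervals and rounds each point
to an endpoint of its edge. Two points of an edge are separated with probability exactly their
distance; this turns the random graph tree into a random tree of the complex. Truncated expected
distance is a semimetric, so a bound on each edge extends along chains.

For the embedding, each edge of a tree is selected independently with probability `1/(2N)`, and a
vertex receives the parity of the selected edges separating it from a root. The expected difference
of two signs is `1 - (1 - 1/N)^d`, `d` the tree distance, which is comparable to `min(d, N)/N`. The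
lower bound uses that trees do not shorten distances in `G`, the upper bound is the edge estimate.
Composing with the rounding map gives functions on the complex, realized in `L1` by transporting the
finite mixture to the unit interval. -/

namespace GraphComplex

/-! ### Average truncated stretch of a spanning forest in a sparse graph -/

section Trees

variable {V : Type*}

/-- The length of an edge of a graph when it is measured in `T` and truncated at `N`. -/
noncomputable def truncDist (T : SimpleGraph V) (N : ℕ) : Sym2 V → ℝ :=
  Sym2.lift ⟨fun u v => min (T.dist u v : ℝ) N, fun u v => by dsimp only; rw [T.dist_comm]⟩

@[simp] lemma truncDist_mk (T : SimpleGraph V) (N : ℕ) (u v : V) :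
    truncDist T N s(u, v) = min (T.dist u v : ℝ) N := rfl

lemma truncDist_le (T : SimpleGraph V) (N : ℕ) (e : Sym2 V) : truncDist T N e ≤ N := by
  induction e using Sym2.ind with
  | h u v => rw [truncDist_mk]; exact min_le_right _ _

lemma truncDist_le_one {T : SimpleGraph V} (N : ℕ) {e : Sym2 V} (he : e ∈ T.edgeSet) :
    truncDist T N e ≤ 1 := by
  induction e using Sym2.ind with
  | h u v =>
    rw [truncDist_mk]
    refine (min_le_left _ _).trans ?_
    rw [SimpleGraph.dist_eq_one_iff_adj.mpr he]; simp

variable [Fintype V]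

lemma dist_add_one_le_card_supp {H : SimpleGraph V} (c : H.ConnectedComponent) {u v : V}
    (hu : u ∈ c.supp) (hv : v ∈ c.supp) : H.dist u v + 1 ≤ c.supp.ncard := by
  classical
  obtain ⟨p, hp⟩ := (c.connected_toSimpleGraph.preconnected ⟨u, hu⟩ ⟨v, hv⟩).exists_isPath
  have h1 := hp.length_lt
  have h2 := SimpleGraph.dist_le (p.map c.toSimpleGraph_hom)
  rw [SimpleGraph.Walk.length_map] at h2
  have h3 : Fintype.card c = c.supp.ncard := by
    rw [← Nat.card_eq_fintype_card]; rfl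
  have h4 : H.dist u v ≤ p.length := h2
  omega

lemma card_supp_le {H : SimpleGraph V} (c : H.ConnectedComponent) :
    c.supp.ncard ≤ {e | e ∈ H.edgeSet ∧ ∀ v ∈ e, v ∈ c.supp}.ncard + 1 := by
  classical
  have h := c.connected_toSimpleGraph.card_vert_le_card_edgeSet_add_one
  have h1 : Nat.card c = c.supp.ncard := rfl
  rw [h1] at h
  refine h.trans (Nat.add_le_add_right ?_ 1)
  refine Nat.card_le_card_of_injective
    (fun e => ⟨Sym2.map Subtype.val e.1, ?_⟩) ?_ (β := ({e | _} : Set (Sym2 V)))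
  · obtain ⟨e, he⟩ := e
    induction e using Sym2.ind with
    | h u v =>
      refine ⟨he, ?_⟩
      intro w hw
      simp only [Sym2.map_mk, Sym2.mem_iff] at hw
      rcases hw with rfl | rfl
      exacts [u.2, v.2]
  · intro e e' hee
    have := congrArg Subtype.val hee
    exact Subtype.ext (Sym2.map.injective Subtype.val_injective this)

-- Let the component have `m` vertices, `t` forest edges and `k` other edges. Connectedness gives `m
-- ≤ t + 1` and sparsity gives `t + k ≤ (1 + δ)m`, hence `k ≤ 1 + δm`: the excess over a unicyclic
-- graph is controlled by `δ`.
open Classical in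
lemma sum_truncDist_component_le {G H H' : SimpleGraph V} {δ : ℝ} (hδ : 0 ≤ δ)
    (hs : IsSparse G δ) (hHG : H ≤ G) (hle : H' ≤ H) (N : ℕ) (c : H'.ConnectedComponent) :
    ∑ e ∈ H.edgeFinset with ∀ v ∈ e, v ∈ c.supp, truncDist H' N e ≤
      (2 + 2 * δ * N) * (H.edgeFinset.filter fun e => ∀ v ∈ e, v ∈ c.supp).card := by
  set E := H.edgeFinset.filter fun e => ∀ v ∈ e, v ∈ c.supp with hE
  have hm := card_supp_le c
  set t := E.filter fun e => e ∈ H'.edgeSet with ht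
  set k := E.filter fun e => e ∉ H'.edgeSet with hk
  have htk : t.card + k.card = E.card := Finset.card_filter_add_card_filter_not _
  have hset : {e | e ∈ H'.edgeSet ∧ ∀ v ∈ e, v ∈ c.supp} = (t : Set (Sym2 V)) := by
    ext e
    simp only [ht, hE, Finset.coe_filter, Finset.mem_filter, SimpleGraph.mem_edgeFinset,
      Set.mem_ofPred_eq]
    exact ⟨fun h => ⟨⟨SimpleGraph.edgeSet_mono hle h.1, h.2⟩, h.1⟩, fun h => ⟨h.2, h.1.2⟩⟩
  rw [hset, Set.ncard_coe_finset] at hm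
  have hn : (E.card : ℝ) ≤ (1 + δ) * c.supp.ncard := by
    have h := hs c.supp.toFinset
    rw [← Set.ncard_eq_toFinset_card'] at h
    refine le_trans ?_ h
    rw [← Set.ncard_coe_finset]
    refine Nat.cast_le.mpr (Set.ncard_le_ncard ?_ (Set.toFinite _))
    intro e he
    simp only [hE, Finset.coe_filter, SimpleGraph.mem_edgeFinset, Set.mem_ofPred_eq] at he
    refine ⟨SimpleGraph.edgeSet_mono hHG he.1, fun v hv => ?_⟩
    simpa using he.2 v hv
  rw [← Finset.sum_filter_add_sum_filter_not E fun e => e ∈ H'.edgeSet]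
  have htsum : ∑ e ∈ t, truncDist H' N e ≤ t.card := by
    refine (Finset.sum_le_card_nsmul _ _ 1 fun e he => ?_).trans (by simp)
    exact truncDist_le_one N (Finset.mem_filter.mp he).2
  have hcost : ∀ e ∈ k, truncDist H' N e ≤ c.supp.ncard - 1 := by
    intro e he
    have he' := (Finset.mem_filter.mp (Finset.mem_filter.mp he).1).2
    induction e using Sym2.ind with
    | h u v =>
      have := dist_add_one_le_card_supp c (he' u (by simp)) (he' v (by simp))
      rw [truncDist_mk]
      refine (min_le_left _ _).trans ?_
      have h : ((H'.dist u v + 1 : ℕ) : ℝ) ≤ c.supp.ncard := Nat.cast_le.mpr this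
      push_cast at h; linarith
  have hmR : (c.supp.ncard : ℝ) ≤ t.card + 1 := by exact_mod_cast hm
  have htkR : (t.card : ℝ) + k.card = E.card := by exact_mod_cast htk
  have hN : (0 : ℝ) ≤ N := Nat.cast_nonneg _
  have hksum : ∑ e ∈ k, truncDist H' N e ≤ (1 + 2 * δ * N) * E.card := by
    have hE0 : (0 : ℝ) ≤ E.card := Nat.cast_nonneg _
    have hδN : 0 ≤ δ * N * E.card := by positivity
    have ht0 : (0 : ℝ) ≤ t.card := Nat.cast_nonneg _
    -- A lone extra edge costs at most `m - 1 ≤ t`, whatever `N` is. If `k ≥ 2`, then `k/2 ≤ k - 1 ≤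
    -- δm` and `m ≤ t + k`, so the trivial cost `N` per extra edge is affordable.
    rcases Nat.lt_or_ge k.card 2 with h2 | h2
    · have h3 : ∑ e ∈ k, truncDist H' N e ≤ k.card * (t.card : ℝ) := by
        refine (Finset.sum_le_card_nsmul _ _ (t.card : ℝ) fun e he => ?_).trans (by simp)
        linarith [hcost e he]
      have h4 : (k.card : ℝ) ≤ 1 := by exact_mod_cast Nat.lt_succ_iff.mp h2
      nlinarith
    · have h3 : ∑ e ∈ k, truncDist H' N e ≤ k.card * (N : ℝ) := by
        refine (Finset.sum_le_card_nsmul _ _ (N : ℝ) fun e _ => truncDist_le _ _ _).trans (by simp)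
      have h4 : (2 : ℝ) ≤ k.card := by exact_mod_cast h2
      have h5 : (k.card : ℝ) ≤ 2 * δ * E.card := by nlinarith
      nlinarith
  change ∑ e ∈ t, truncDist H' N e + ∑ e ∈ k, truncDist H' N e ≤ _
  have : (t.card : ℝ) ≤ E.card := by
    have : (0 : ℝ) ≤ k.card := Nat.cast_nonneg _
    linarith
  linarith

open Classical in
/-- If `H'` joins the ends of each edge of a subgraph `H` of a sparse graph, then the truncated
`H'`-distance between the ends of an edge of `H` is bounded on average. -/
lemma sum_truncDist_le {G H H' : SimpleGraph V} {δ : ℝ} (hδ : 0 ≤ δ)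
    (hs : IsSparse G δ) (hHG : H ≤ G) (hle : H' ≤ H)
    (hr : ∀ u v, H.Adj u v → H'.Reachable u v) (N : ℕ) :
    ∑ e ∈ H.edgeFinset, truncDist H' N e ≤ (2 + 2 * δ * N) * H.edgeFinset.card := by
  have : Fintype H'.ConnectedComponent := Fintype.ofFinite _
  -- Both ends of an edge of `H` lie in the same component of `H'`, so the arbitrary choice of an
  -- end does not matter.
  let comp : Sym2 V → H'.ConnectedComponent := fun e => H'.connectedComponentMk (Quot.out e).1
  have hfib : ∀ c, (H.edgeFinset.filter fun e => comp e = c) =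
      H.edgeFinset.filter fun e => ∀ v ∈ e, v ∈ c.supp := by
    intro c
    refine Finset.filter_congr fun e he => ?_
    rw [SimpleGraph.mem_edgeFinset] at he
    have hmem : (Quot.out e).1 ∈ e := Sym2.out_fst_mem e
    constructor
    · rintro rfl v hv
      rw [SimpleGraph.ConnectedComponent.mem_supp_iff, SimpleGraph.ConnectedComponent.eq]
      by_cases hvw : v = (Quot.out e).1
      · rw [hvw]
      · have : e = s(v, (Quot.out e).1) := (Sym2.mem_and_mem_iff hvw).mp ⟨hv, hmem⟩
        rw [this] at he
        exact hr _ _ he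
    · intro h
      exact h _ hmem
  rw [← Finset.sum_fiberwise H.edgeFinset comp, Finset.card_eq_sum_card_fiberwise
    (f := comp) (t := Finset.univ) (fun _ _ => Finset.mem_coe.mpr (Finset.mem_univ _)),
    Nat.cast_sum, Finset.mul_sum]
  refine Finset.sum_le_sum fun c _ => ?_
  rw [hfib c]
  exact sum_truncDist_component_le hδ hs hHG hle N c

end Trees

/-! ### Maximum-weight spanning forests -/

section Greedy

variable {V : Type*}

/-- The subgraph of `G` formed by the edges with the property `p`. -/
def restrictEdges (G : SimpleGraph V) (p : Sym2 V → Prop) : SimpleGraph V where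
  Adj u v := G.Adj u v ∧ p s(u, v)
  symm := ⟨fun u v h => ⟨h.1.symm, by rw [Sym2.eq_swap]; exact h.2⟩⟩
  loopless := ⟨fun u h => G.irrefl h.1⟩

lemma restrictEdges_le (G : SimpleGraph V) (p : Sym2 V → Prop) : restrictEdges G p ≤ G :=
  fun _ _ h => h.1

lemma restrictEdges_mono {G G' : SimpleGraph V} (hG : G ≤ G') {p q : Sym2 V → Prop}
    (hpq : ∀ e, p e → q e) : restrictEdges G p ≤ restrictEdges G' q :=
  fun _ _ h => ⟨hG h.1, hpq _ h.2⟩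

lemma mem_edgeSet_restrictEdges {G : SimpleGraph V} {p : Sym2 V → Prop} {e : Sym2 V} :
    e ∈ (restrictEdges G p).edgeSet ↔ e ∈ G.edgeSet ∧ p e := by
  induction e using Sym2.ind with
  | h u v => rfl

variable {κ : Type*} [LinearOrder κ]

/-- The result of the greedy algorithm for a spanning forest of maximal weight: the edges whose
ends are not joined by the edges of larger weight. -/
def greedyForest (G : SimpleGraph V) (key : Sym2 V → κ) : SimpleGraph V where
  Adj u v := G.Adj u v ∧ ¬ (restrictEdges G fun e => key s(u, v) < key e).Reachable u v
  symm := ⟨fun u v h => ⟨h.1.symm, fun hr => h.2 (by rw [Sym2.eq_swap]; exact hr.symm)⟩⟩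
  loopless := ⟨fun u h => G.irrefl h.1⟩

lemma greedyForest_le (G : SimpleGraph V) (key : Sym2 V → κ) : greedyForest G key ≤ G :=
  fun _ _ h => h.1

/-- On a cycle, the edge of least key has its ends joined by the rest of the cycle, all of whose
edges have larger key, so it would have been rejected. -/
lemma greedyForest_isAcyclic (G : SimpleGraph V) {key : Sym2 V → κ}
    (hkey : Function.Injective key) : (greedyForest G key).IsAcyclic := by
  classical
  intro x c hc
  obtain ⟨e, he, hmin⟩ := c.edges.toFinset.exists_min_image key (by
    rw [List.toFinset_nonempty_iff]
    intro h
    have h3 := hc.three_le_length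
    rw [← c.length_edges, h] at h3
    simp at h3)
  rw [List.mem_toFinset] at he
  let C : SimpleGraph V := SimpleGraph.fromEdgeSet {e | e ∈ c.edges}
  have hcC : ∀ e ∈ c.edges, e ∈ C.edgeSet := by
    intro e he
    rw [SimpleGraph.edgeSet_fromEdgeSet]
    exact ⟨he, SimpleGraph.not_isDiag_of_mem_edgeSet _ (c.edges_subset_edgeSet he)⟩
  induction e using Sym2.ind with
  | h u v =>
    have h1 := SimpleGraph.adj_and_reachable_delete_edges_iff_exists_cycle.mpr
      ⟨x, c.transfer C hcC, hc.transfer hcC, by rwa [SimpleGraph.Walk.edges_transfer]⟩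
    have h2 : (greedyForest G key).Adj u v := c.edges_subset_edgeSet he
    refine h2.2 (h1.2.mono ?_)
    intro a b hab
    rw [SimpleGraph.deleteEdges, SimpleGraph.sdiff_adj, SimpleGraph.fromEdgeSet_adj,
      SimpleGraph.fromEdgeSet_adj] at hab
    have hmem : s(a, b) ∈ c.edges := hab.1.1
    refine ⟨greedyForest_le _ _ (c.edges_subset_edgeSet hmem : (greedyForest G key).Adj a b), ?_⟩
    refine lt_of_le_of_ne (hmin _ (List.mem_toFinset.mpr hmem)) fun h => ?_
    exact hab.2 ⟨(hkey h).symm, hab.1.2⟩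

/-- Induction from the largest key downwards: a rejected edge is bypassed by a walk of edges with
larger keys, each already bypassed within the forest. This is what makes the forest span all
superlevel graphs simultaneously. -/
lemma greedyForest_reachable [Finite V] (G : SimpleGraph V) (key : Sym2 V → κ) {u v : V}
    (huv : G.Adj u v) :
    (restrictEdges (greedyForest G key) fun e => key s(u, v) ≤ key e).Reachable u v := by
  have key_wf : WellFounded fun e e' : Sym2 V => key e' < key e :=
    Finite.wellFounded_of_trans_of_irrefl (r := fun e e' : Sym2 V => key e' < key e)
  suffices ∀ e : Sym2 V, ∀ u v, e = s(u, v) → G.Adj u v →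
      (restrictEdges (greedyForest G key) fun e => key s(u, v) ≤ key e).Reachable u v from
    this _ u v rfl huv
  intro e
  induction e using key_wf.induction with
  | h e ih =>
    rintro u v rfl huv
    by_cases h : (restrictEdges G fun e => key s(u, v) < key e).Reachable u v
    · obtain ⟨p⟩ := h
      suffices ∀ a b (p : (restrictEdges G fun e => key s(u, v) < key e).Walk a b),
          (restrictEdges (greedyForest G key) fun e => key s(u, v) ≤ key e).Reachable a b from
        this _ _ p
      intro a b p
      induction p with
      | nil => exact SimpleGraph.Reachable.refl _
      | cons hab _ ih' =>
        refine SimpleGraph.Reachable.trans ?_ ih'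
        exact (ih _ hab.2 _ _ rfl hab.1).mono
          (restrictEdges_mono le_rfl fun e he => hab.2.le.trans he)
    · exact SimpleGraph.Adj.reachable (G := restrictEdges _ _) ⟨⟨huv, h⟩, le_rfl⟩

end Greedy

/-! ### Layer-cake summation and minimax duality -/

/-- Summation by layers: if the sum of `c` over each super-level set of the weight is
nonpositive, so is the weighted sum. -/
lemma sum_mul_nonpos_of_forall_level {ι : Type*} (s : Finset ι) (c : ι → ℝ) (w : ι → ℝ)
    (hw : ∀ i, 0 ≤ w i) (h : ∀ t, 0 < t → ∑ i ∈ s with t ≤ w i, c i ≤ 0) :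
    ∑ i ∈ s, w i * c i ≤ 0 := by
  induction hn : (s.filter fun i => 0 < w i).card using Nat.strong_induction_on generalizing w with
  | _ n ih =>
    by_cases hne : (s.filter fun i => 0 < w i).Nonempty
    · obtain ⟨j, hj, hmin⟩ := Finset.exists_min_image _ w hne
      rw [Finset.mem_filter] at hj
      set m := w j with hm
      -- The bottom layer, of height `m` the least positive weight, is peeled off; fewer weights
      -- remain positive, which drives the induction.
      have h1 : ∑ i ∈ s, w i * c i =
          ∑ i ∈ s, max (w i - m) 0 * c i + m * ∑ i ∈ s with m ≤ w i, c i := by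
        rw [Finset.mul_sum, Finset.sum_filter, ← Finset.sum_add_distrib]
        refine Finset.sum_congr rfl fun i hi => ?_
        split_ifs with hmi
        · rw [max_eq_left (by linarith)]; ring
        · have : w i = 0 := by
            by_contra h0
            exact hmi (hmin i (Finset.mem_filter.mpr ⟨hi, lt_of_le_of_ne (hw i) (Ne.symm h0)⟩))
          rw [max_eq_right (by linarith), this]; ring
      have h2 : ∑ i ∈ s, max (w i - m) 0 * c i ≤ 0 := by
        refine ih _ ?_ (fun i => max (w i - m) 0) (fun i => le_max_right _ _) ?_ rfl
        · rw [← hn]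
          refine Finset.card_lt_card ?_
          rw [Finset.ssubset_iff_of_subset]
          · exact ⟨j, Finset.mem_filter.mpr hj, by simp [hm]⟩
          · intro i hi
            simp only [Finset.mem_filter, lt_max_iff, lt_irrefl, or_false] at hi ⊢
            exact ⟨hi.1, by linarith [hj.2]⟩
        · intro t ht
          convert h (t + m) (by linarith [hj.2]) using 2
          ext i
          simp only [Finset.mem_filter, le_max_iff, not_le.mpr ht, or_false, le_sub_iff_add_le]
      have h3 := h m hj.2
      have h4 : m * ∑ i ∈ s with m ≤ w i, c i ≤ 0 := mul_nonpos_of_nonneg_of_nonpos hj.2.le h3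
      linarith
    · refine le_of_eq (Finset.sum_eq_zero fun i hi => ?_)
      have : ¬ 0 < w i := fun h0 => hne ⟨i, Finset.mem_filter.mpr ⟨hi, h0⟩⟩
      rw [le_antisymm (not_lt.mp this) (hw i), zero_mul]

/-- The minimax principle for a finite family of cost vectors: if each nonnegative combination
of the costs can be made small, then a convex combination of the cost vectors is small. -/
lemma exists_convex_weights_of_forall_exists_le {τ ι : Type*} [Fintype τ] [Fintype ι]
    (c : τ → ι → ℝ) (B : ℝ)
    (h : ∀ w : ι → ℝ, (∀ i, 0 ≤ w i) → ∃ t, ∑ i, w i * c t i ≤ B * ∑ i, w i) :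
    ∃ p : τ → ℝ, (∀ t, 0 ≤ p t) ∧ ∑ t, p t = 1 ∧ ∀ i, ∑ t, p t * c t i ≤ B := by
  classical
  let K : Set (ι → ℝ) := (Fintype.linearCombination ℝ c) '' stdSimplex ℝ τ
  have hKconv : Convex ℝ K := (convex_stdSimplex ℝ τ).linear_image _
  have hKcomp : IsCompact K :=
    (isCompact_stdSimplex ℝ τ).image (LinearMap.continuous_of_finiteDimensional _)
  have hcK : ∀ t, c t ∈ K := fun t =>
    ⟨Pi.single t 1, single_mem_stdSimplex ℝ t, by simp⟩
  -- If the convex hull of the costs misses the orthant below `B`, a separating functional provides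
  -- weights violating `h`.
  by_cases hd : Disjoint K (Set.Iic fun _ => B)
  · exfalso
    obtain ⟨f, a, b, hfa, hab, hfb⟩ :=
      geometric_hahn_banach_compact_closed hKconv hKcomp (convex_Iic _) isClosed_Iic hd
    have hf : ∀ x : ι → ℝ, f x = ∑ i, x i * f (Pi.single i 1) := by
      intro x
      conv_lhs => rw [← Finset.univ_sum_single x, map_sum]
      refine Finset.sum_congr rfl fun i _ => ?_
      rw [← smul_eq_mul, ← map_smul, ← Pi.single_smul, smul_eq_mul, mul_one]
    -- The functional is bounded below on an orthant that is unbounded in the negative directions,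
    -- so its coefficients cannot be positive; `r` is chosen to descend past the bound `b`.
    have hw : ∀ i, 0 ≤ -f (Pi.single i 1) := by
      intro i
      by_contra! hneg
      set q := f (Pi.single i 1) with hq
      have hq0 : 0 < q := by linarith
      set r := |f (fun _ => B) - b| / q with hr
      have hr0 : 0 ≤ r := by positivity
      have h1 := hfb ((fun _ => B) - r • Pi.single i 1) (by
        intro j
        by_cases hj : j = i <;> simp [hj, hr0])
      rw [map_sub, map_smul, smul_eq_mul, ← hq, hr, div_mul_cancel₀ _ hq0.ne'] at h1
      linarith [le_abs_self (f (fun _ => B) - b)]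
    obtain ⟨t, ht⟩ := h _ hw
    have h1 := hfa _ (hcK t)
    have h2 := hfb (fun _ => B) (Set.mem_Iic.mpr le_rfl)
    rw [hf] at h1 h2
    simp only [neg_mul, Finset.sum_neg_distrib, ← Finset.mul_sum] at ht h2
    simp only [mul_comm (c t _)] at h1
    linarith
  · obtain ⟨x, ⟨p, hp, rfl⟩, hx⟩ := Set.not_disjoint_iff.mp hd
    refine ⟨p, hp.1, hp.2, fun i => ?_⟩
    have := hx i
    simpa [Fintype.linearCombination_apply] using this

/-! ### The random spanning tree of the graph -/

section RandomTree

variable {V : Type*} [Fintype V]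

open Classical in
/-- Some spanning tree of a sparse graph has a small weighted average of its truncated
distances. -/
lemma exists_isTree_sum_mul_truncDist_le {G : SimpleGraph V} {δ : ℝ} (hδ : 0 ≤ δ)
    (hG : G.Connected) (hs : IsSparse G δ) (N : ℕ) (w : Sym2 V → ℝ) (hw : ∀ e, 0 ≤ w e) :
    ∃ T ≤ G, T.IsTree ∧ ∑ e ∈ G.edgeFinset, w e * truncDist T N e ≤
      (2 + 2 * δ * N) * ∑ e ∈ G.edgeFinset, w e := by
  -- The second coordinate breaks ties between equal weights, making the key injective as acyclicity
  -- requires.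
  let key : Sym2 V → ℝ ×ₗ Fin (Fintype.card (Sym2 V)) :=
    fun e => toLex (w e, Fintype.equivFin _ e)
  have hkey : Function.Injective key := fun e e' h =>
    (Fintype.equivFin _).injective (congrArg (fun x => (ofLex x).2) h)
  have hmono : ∀ e e', key e ≤ key e' → w e ≤ w e' := fun e e' h => by
    rcases Prod.Lex.le_iff.mp h with h | h
    exacts [h.le, h.1.le]
  set T := greedyForest G key
  have hreach : ∀ u v, G.Adj u v → ∀ H ≤ G, (∀ e ∈ G.edgeSet, w s(u, v) ≤ w e → e ∈ H.edgeSet) →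
      (T ⊓ H).Reachable u v := by
    intro u v huv H _ hH
    refine (greedyForest_reachable G key huv).mono ?_
    intro a b hab
    refine ⟨hab.1, ?_⟩
    exact hH s(a, b) (greedyForest_le _ _ hab.1) (hmono _ _ hab.2)
  have hT : T.IsTree := by
    refine ⟨?_, greedyForest_isAcyclic G hkey⟩
    have := hG.nonempty
    refine ⟨fun u v => ?_⟩
    obtain ⟨p⟩ := hG.preconnected u v
    induction p with
    | nil => exact SimpleGraph.Reachable.refl _
    | cons hab _ ih =>
      exact ((hreach _ _ hab G le_rfl fun e he _ => he).mono inf_le_left).trans ih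
  refine ⟨T, greedyForest_le _ _, hT, ?_⟩
  rw [← sub_nonpos, Finset.mul_sum, ← Finset.sum_sub_distrib]
  have := sum_mul_nonpos_of_forall_level G.edgeFinset
    (fun e => truncDist T N e - (2 + 2 * δ * N)) w hw ?_
  · refine le_trans (le_of_eq (Finset.sum_congr rfl fun e _ => ?_)) this
    ring
  · intro t _
    set H := restrictEdges G fun e => t ≤ w e with hH
    have hHe : G.edgeFinset.filter (fun e => t ≤ w e) = H.edgeFinset := by
      ext e
      rw [Finset.mem_filter, SimpleGraph.mem_edgeFinset, SimpleGraph.mem_edgeFinset, hH,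
        mem_edgeSet_restrictEdges]
    have hr : ∀ u v, H.Adj u v → (T ⊓ H).Reachable u v := fun u v huv =>
      hreach u v huv.1 H (restrictEdges_le _ _) fun e he hle =>
        mem_edgeSet_restrictEdges.mpr ⟨he, huv.2.trans hle⟩
    have h := sum_truncDist_le hδ hs (restrictEdges_le G _) (inf_le_right : T ⊓ H ≤ H) hr N
    rw [hHe, Finset.sum_sub_distrib, Finset.sum_const, nsmul_eq_mul]
    -- The average was bounded for `T ⊓ H`, which already joins the ends of edges of `H`; passing to
    -- the larger graph `T` only shortens distances.
    have h2 : ∑ e ∈ H.edgeFinset, truncDist T N e ≤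
        ∑ e ∈ H.edgeFinset, truncDist (T ⊓ H) N e := by
      refine Finset.sum_le_sum fun e he => ?_
      rw [SimpleGraph.mem_edgeFinset] at he
      induction e using Sym2.ind with
      | h u v =>
        rw [truncDist_mk, truncDist_mk]
        exact min_le_min_right _ (Nat.cast_le.mpr ((hr u v he).dist_anti inf_le_left))
    linarith

/-- The spanning trees of a graph. -/
abbrev GraphTree (G : SimpleGraph V) : Type _ := {T : SimpleGraph V // T ≤ G ∧ T.IsTree}

noncomputable instance (G : SimpleGraph V) : Fintype (GraphTree G) := Fintype.ofFinite _

/-- A sparse graph has a random spanning tree whose expected truncated distances are small on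
all edges. -/
lemma exists_random_tree {G : SimpleGraph V} {δ : ℝ} (hδ : 0 ≤ δ)
    (hG : G.Connected) (hs : IsSparse G δ) (N : ℕ) :
    ∃ p : GraphTree G → ℝ, (∀ T, 0 ≤ p T) ∧ ∑ T, p T = 1 ∧
      ∀ u v, G.Adj u v → ∑ T, p T * min (T.1.dist u v : ℝ) N ≤ 2 + 2 * δ * N := by
  classical
  have hB : 0 ≤ 2 + 2 * δ * N := by positivity
  obtain ⟨p, hp0, hp1, hp⟩ := exists_convex_weights_of_forall_exists_le
    (τ := GraphTree G) (ι := Sym2 V)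
    (fun T e => if e ∈ G.edgeFinset then truncDist T.1 N e else 0) (2 + 2 * δ * N) (by
      intro w hw
      obtain ⟨T, hTG, hT, h⟩ := exists_isTree_sum_mul_truncDist_le hδ hG hs N w hw
      refine ⟨⟨T, hTG, hT⟩, ?_⟩
      simp only [mul_ite, mul_zero]
      rw [Finset.sum_ite_mem, Finset.univ_inter]
      exact h.trans (mul_le_mul_of_nonneg_left (Finset.sum_le_univ_sum_of_nonneg hw) hB))
  refine ⟨p, hp0, hp1, fun u v huv => ?_⟩
  have := hp s(u, v)
  have he : s(u, v) ∈ G.edgeFinset := SimpleGraph.mem_edgeFinset.mpr huv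
  simpa only [if_pos he, truncDist_mk] using this

end RandomTree

/-! ### Path metrics glued from pieces -/

section Chains

variable {E : Type*} [PseudoEMetricSpace E] {𝒜 : Set (Set E)}

lemma chainEDist_le_sum {x y : E} (n : ℕ) (p : ℕ → E) (h0 : p 0 = x) (hn : p n = y)
    (hp : ∀ i < n, ∃ A ∈ 𝒜, p i ∈ A ∧ p (i + 1) ∈ A) :
    chainEDist 𝒜 x y ≤ ∑ i ∈ Finset.range n, edist (p i) (p (i + 1)) :=
  iInf_le_of_le n <| iInf_le_of_le p <| iInf_le_of_le h0 <| iInf_le_of_le hn <|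
    iInf_le_of_le hp le_rfl

lemma chainEDist_lt_iff {x y : E} {c : ℝ≥0∞} : chainEDist 𝒜 x y < c ↔
    ∃ (n : ℕ) (p : ℕ → E), p 0 = x ∧ p n = y ∧
      (∀ i < n, ∃ A ∈ 𝒜, p i ∈ A ∧ p (i + 1) ∈ A) ∧
      ∑ i ∈ Finset.range n, edist (p i) (p (i + 1)) < c := by
  simp only [chainEDist, iInf_lt_iff, exists_prop]

lemma chainEDist_self (x : E) : chainEDist 𝒜 x x = 0 :=
  le_antisymm ((chainEDist_le_sum 0 (fun _ => x) rfl rfl (by simp)).trans (by simp)) zero_le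

lemma chainEDist_le_edist {A : Set E} (hA : A ∈ 𝒜) {x y : E} (hx : x ∈ A) (hy : y ∈ A) :
    chainEDist 𝒜 x y ≤ edist x y := by
  refine (chainEDist_le_sum 1 (fun i => if i = 0 then x else y) (by simp) (by simp) ?_).trans
    (by simp)
  intro i hi
  obtain rfl : i = 0 := by omega
  exact ⟨A, hA, by simpa using hx, by simpa using hy⟩

lemma chainEDist_triangle (x y z : E) :
    chainEDist 𝒜 x z ≤ chainEDist 𝒜 x y + chainEDist 𝒜 y z := by
  refine le_of_forall_gt fun c hc => ?_
  obtain ⟨a, b, ha, hb, hab⟩ : ∃ a b, chainEDist 𝒜 x y < a ∧ chainEDist 𝒜 y z < b ∧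
      a + b ≤ c := by
    have hfin := ENNReal.add_ne_top.mp (ne_top_of_lt hc)
    obtain ⟨r, hr, hrc⟩ := ENNReal.lt_iff_exists_add_pos_lt.mp hc
    have hr' : (r : ℝ≥0∞) / 2 ≠ 0 := by simp [hr.ne']
    refine ⟨_, _, ENNReal.lt_add_right hfin.1 hr', ENNReal.lt_add_right hfin.2 hr', ?_⟩
    rw [add_add_add_comm, ENNReal.add_halves]
    exact hrc.le
  obtain ⟨n, p, hp0, hpn, hp, hps⟩ := chainEDist_lt_iff.mp ha
  obtain ⟨m, q, hq0, hqm, hq, hqs⟩ := chainEDist_lt_iff.mp hb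
  let r : ℕ → E := fun i => if i ≤ n then p i else q (i - n)
  have hr1 : ∀ i ≤ n, r i = p i := fun i hi => if_pos hi
  have hr2 : ∀ i, r (n + i) = q i := by
    intro i
    rcases Nat.eq_zero_or_pos i with rfl | hi
    · simp [r, hpn, hq0]
    · simp [r, hi.ne']
  refine (chainEDist_le_sum (n + m) r (by rw [hr1 0 (Nat.zero_le _), hp0])
    (by rw [hr2, hqm]) ?_).trans_lt ?_
  · intro i hi
    by_cases hin : i < n
    · rw [hr1 i hin.le, hr1 (i + 1) hin]
      exact hp i hin
    · obtain ⟨j, rfl⟩ := Nat.exists_eq_add_of_le (not_lt.mp hin)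
      rw [hr2, add_assoc, hr2]
      exact hq j (by omega)
  · rw [Finset.sum_range_add]
    refine lt_of_lt_of_le (ENNReal.add_lt_add ?_ ?_) hab
    · refine lt_of_eq_of_lt (Finset.sum_congr rfl fun i hi => ?_) hps
      rw [Finset.mem_range] at hi
      rw [hr1 i hi.le, hr1 (i + 1) hi]
    · refine lt_of_eq_of_lt (Finset.sum_congr rfl fun i _ => ?_) hqs
      rw [hr2, add_assoc, hr2]

/-- A semimetric that is bounded by a multiple of the distance on each piece is bounded by the
same multiple of the path distance. -/
lemma le_mul_chainEDist {S : Set E} (hS : ∀ A ∈ 𝒜, A ⊆ S) {ρ : S → S → ℝ≥0∞} {K : ℝ≥0∞}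
    (hK0 : K ≠ 0) (hK : K ≠ ⊤) (hself : ∀ x, ρ x x = 0)
    (htri : ∀ x y z, ρ x z ≤ ρ x y + ρ y z)
    (hpiece : ∀ A ∈ 𝒜, ∀ x y : S, (x : E) ∈ A → (y : E) ∈ A → ρ x y ≤ K * edist (x : E) y)
    (x y : S) : ρ x y ≤ K * chainEDist 𝒜 (x : E) (y : E) := by
  rw [mul_comm, ← ENNReal.div_le_iff hK0 hK]
  refine le_iInf fun n => le_iInf fun p => le_iInf fun h0 => le_iInf fun hn => le_iInf fun hp => ?_
  rw [ENNReal.div_le_iff hK0 hK, mul_comm]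
  induction n generalizing y with
  | zero =>
    obtain rfl : x = y := Subtype.ext (h0.symm.trans hn)
    rw [hself]
    exact zero_le
  | succ n ih =>
    obtain ⟨A, hA, hA1, hA2⟩ := hp n (Nat.lt_succ_self n)
    rw [Finset.sum_range_succ, mul_add]
    refine (htri x ⟨p n, hS A hA hA1⟩ y).trans (add_le_add ?_ ?_)
    · exact ih _ rfl fun i hi => hp i (hi.trans (Nat.lt_succ_self n))
    · rw [hn] at hA2 ⊢
      exact hpiece A hA _ _ hA1 hA2

end Chains

/-! ### Geometry of the unit intervals -/

section Edges

variable {V : Type*}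

@[simp] lemma vertex_self (v : V) : vertex v v = 1 := by
  classical
  simp [vertex]

lemma vertex_of_ne {u v : V} (h : v ≠ u) : vertex u v = 0 := by
  classical
  simp [vertex, h]

lemma edge_comm (u v : V) : edge u v = edge v u := segment_symm _ _ _

lemma vertex_mem_edge_left (u v : V) : vertex u ∈ edge u v := left_mem_segment _ _ _

lemma vertex_mem_edge_right (u v : V) : vertex v ∈ edge u v := right_mem_segment _ _ _

lemma mem_edge_iff {u v : V} (huv : u ≠ v) {x : V → ℝ} : x ∈ edge u v ↔
    0 ≤ x u ∧ 0 ≤ x v ∧ x u + x v = 1 ∧ ∀ w, w ≠ u → w ≠ v → x w = 0 := by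
  constructor
  · rintro ⟨a, b, ha, hb, hab, rfl⟩
    simp only [Pi.add_apply, Pi.smul_apply, smul_eq_mul, vertex_self, vertex_of_ne huv,
      vertex_of_ne huv.symm, mul_one, mul_zero, add_zero, zero_add]
    refine ⟨ha, hb, hab, fun w hu hv => ?_⟩
    rw [vertex_of_ne hu, vertex_of_ne hv]; simp
  · rintro ⟨hu, hv, huv1, h⟩
    refine ⟨x u, x v, hu, hv, huv1, ?_⟩
    funext w
    simp only [Pi.add_apply, Pi.smul_apply, smul_eq_mul]
    by_cases hwu : w = u
    · subst hwu; simp [vertex_of_ne huv]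
    · by_cases hwv : w = v
      · subst hwv; simp [vertex_of_ne huv.symm]
      · rw [vertex_of_ne hwu, vertex_of_ne hwv, h w hwu hwv]; simp

lemma edges_subset_complex {G : SimpleGraph V} {A : Set (V → ℝ)} (hA : A ∈ edges G) :
    A ⊆ complex G := by
  obtain ⟨u, v, h, rfl⟩ := hA
  exact fun x hx => Or.inr ⟨u, v, h, hx⟩

variable [Fintype V]

lemma edist_of_mem_edge {u v : V} (huv : u ≠ v) {x y : V → ℝ} (hx : x ∈ edge u v)
    (hy : y ∈ edge u v) : edist x y = ENNReal.ofReal |x u - y u| := by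
  rw [mem_edge_iff huv] at hx hy
  refine le_antisymm ?_ ?_
  · refine edist_pi_le_iff.mpr fun w => ?_
    rw [edist_dist, Real.dist_eq]
    refine ENNReal.ofReal_le_ofReal ?_
    by_cases hwu : w = u
    · rw [hwu]
    · by_cases hwv : w = v
      · rw [hwv, ← abs_neg]
        refine le_of_eq (congrArg _ ?_)
        linarith [hx.2.2.1, hy.2.2.1]
      · rw [hx.2.2.2 w hwu hwv, hy.2.2.2 w hwu hwv]; simp
  · rw [← Real.dist_eq, ← edist_dist]
    exact edist_le_pi_edist x y u

lemma edist_le_one_of_mem_edge {u v : V} (huv : u ≠ v) {x y : V → ℝ} (hx : x ∈ edge u v)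
    (hy : y ∈ edge u v) : edist x y ≤ 1 := by
  rw [edist_of_mem_edge huv hx hy, ← ENNReal.ofReal_one]
  rw [mem_edge_iff huv] at hx hy
  refine ENNReal.ofReal_le_ofReal (abs_le.mpr ⟨?_, ?_⟩) <;> linarith [hx.2.2.1, hy.2.2.1]

lemma chainEDist_vertex_le_length {H : SimpleGraph V} {𝒜 : Set (Set (V → ℝ))}
    (h𝒜 : edges H ⊆ 𝒜) {u v : V} (p : H.Walk u v) :
    chainEDist 𝒜 (vertex u) (vertex v) ≤ p.length := by
  induction p with
  | nil => rw [chainEDist_self]; exact zero_le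
  | @cons u v w h p ih =>
    refine (chainEDist_triangle _ (vertex v) _).trans ?_
    rw [SimpleGraph.Walk.length_cons, Nat.cast_add, Nat.cast_one, add_comm]
    refine add_le_add ih ?_
    refine (chainEDist_le_edist (h𝒜 ⟨_, _, h, rfl⟩) (vertex_mem_edge_left _ _)
      (vertex_mem_edge_right _ _)).trans ?_
    exact edist_le_one_of_mem_edge h.ne (vertex_mem_edge_left _ _) (vertex_mem_edge_right _ _)

lemma chainEDist_vertex_le_dist {H : SimpleGraph V} (hH : H.Connected) {𝒜 : Set (Set (V → ℝ))}
    (h𝒜 : edges H ⊆ 𝒜) (u v : V) :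
    chainEDist 𝒜 (vertex u) (vertex v) ≤ H.dist u v := by
  obtain ⟨p, hp⟩ := hH.exists_walk_length_eq_dist u v
  rw [← hp]
  exact chainEDist_vertex_le_length h𝒜 p

end Edges

/-! ### Rounding points to vertices by a threshold -/

section Rounding

/-- The set of thresholds, with the Lebesgue measure `thresholdMeasure`. -/
abbrev Threshold : Type := Set.Ico (0 : ℝ) 1

/-- The uniform distribution on the thresholds. -/
noncomputable def thresholdMeasure : Measure Threshold :=
  (volume : Measure ℝ).comap Subtype.val

lemma thresholdMeasure_preimage (t : Set ℝ) :
    thresholdMeasure (Subtype.val ⁻¹' t) = volume (t ∩ Set.Ico 0 1) := by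
  rw [thresholdMeasure, (MeasurableEmbedding.subtype_coe measurableSet_Ico).comap_preimage,
    Subtype.range_coe]

instance : IsProbabilityMeasure thresholdMeasure :=
  ⟨by simpa using thresholdMeasure_preimage Set.univ⟩

variable {V : Type*} [Fintype V] [LinearOrder V] [Nonempty V]

/-- The vertex `a` to which the threshold `θ` rounds a point `x` of the complex: the coordinates
of `x` partition `[0,1)` into intervals in the order of the vertices, and `θ` lies in that
of `a`. -/
noncomputable def roundTo (θ : ℝ) (x : V → ℝ) : V :=
  Classical.epsilon fun a => ∑ w with w < a, x w ≤ θ ∧ θ < ∑ w with w ≤ a, x w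

/-- Partial sums of a nonnegative vector are monotone, so only one vertex satisfies the defining
condition of `roundTo`. -/
lemma roundTo_eq {θ : ℝ} {x : V → ℝ} {a : V} (hx : ∀ w, 0 ≤ x w)
    (h1 : ∑ w with w < a, x w ≤ θ) (h2 : θ < ∑ w with w ≤ a, x w) : roundTo θ x = a := by
  have key : ∀ a b : V, θ < ∑ w with w ≤ a, x w → ∑ w with w < b, x w ≤ θ → b ≤ a := by
    intro a b ha hb
    by_contra! hab
    refine absurd (ha.trans_le ?_) (not_lt.mpr hb)
    refine Finset.sum_le_sum_of_subset_of_nonneg ?_ fun w _ _ => hx w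
    intro w
    simp only [Finset.mem_filter, Finset.mem_univ, true_and]
    exact fun hw => hw.trans_lt hab
  have hs := Classical.epsilon_spec
    (p := fun a => ∑ w with w < a, x w ≤ θ ∧ θ < ∑ w with w ≤ a, x w) ⟨a, h1, h2⟩
  exact le_antisymm (key _ _ h2 hs.1) (key _ _ hs.2 h1)

lemma roundTo_of_mem_edge {u v : V} (huv : u < v) {x : V → ℝ} (hx : x ∈ edge u v) {θ : ℝ}
    (hθ : θ ∈ Set.Ico (0 : ℝ) 1) : roundTo θ x = if θ < x u then u else v := by
  obtain ⟨hu, hv, h1, h0⟩ := (mem_edge_iff huv.ne).mp hx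
  have hpos : ∀ w, 0 ≤ x w := by
    intro w
    by_cases hwu : w = u
    · rwa [hwu]
    · by_cases hwv : w = v
      · rwa [hwv]
      · rw [h0 w hwu hwv]
  split_ifs with hlt
  · refine roundTo_eq hpos ?_ ?_
    · rw [Finset.sum_eq_zero fun w hw => ?_]
      · exact hθ.1
      · have hw : w < u := by simpa using hw
        exact h0 w hw.ne (hw.trans huv).ne
    · exact hlt.trans_le (Finset.single_le_sum (f := x) (fun w _ => hpos w) (by simp))
  · refine roundTo_eq hpos ?_ ?_
    · rw [Finset.sum_eq_single_of_mem u (by simpa using huv)]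
      · exact not_lt.mp hlt
      · intro w hw hwu
        have hw : w < v := by simpa using hw
        exact h0 w hwu hw.ne
    · refine hθ.2.trans_le ?_
      rw [← h1, ← Finset.sum_pair huv.ne]
      refine Finset.sum_le_sum_of_subset_of_nonneg ?_ fun w _ _ => hpos w
      intro w hw
      rcases Finset.mem_insert.mp hw with rfl | hw
      · simpa using huv.le
      · rw [Finset.mem_singleton.mp hw]; simp

lemma roundTo_vertex {θ : ℝ} (hθ : θ ∈ Set.Ico (0 : ℝ) 1) (v : V) :
    roundTo θ (vertex v) = v := by
  have hpos : ∀ w, 0 ≤ vertex v w := by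
    intro w
    by_cases hwv : w = v
    · rw [hwv, vertex_self]; exact zero_le_one
    · rw [vertex_of_ne hwv]
  refine roundTo_eq hpos ?_ ?_
  · rw [Finset.sum_eq_zero fun w hw => ?_]
    · exact hθ.1
    · have hw : w < v := by simpa using hw
      exact vertex_of_ne hw.ne
  · refine hθ.2.trans_le ?_
    rw [← vertex_self v]
    exact Finset.single_le_sum (f := vertex v) (fun w _ => hpos w) (by simp)

lemma roundTo_eq_or {u v : V} (huv : u ≠ v) {x : V → ℝ} (hx : x ∈ edge u v) {θ : ℝ}
    (hθ : θ ∈ Set.Ico (0 : ℝ) 1) : roundTo θ x = u ∨ roundTo θ x = v := by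
  rcases lt_or_gt_of_ne huv with h | h
  · rw [roundTo_of_mem_edge h hx hθ]
    split_ifs <;> simp
  · rw [edge_comm] at hx
    rw [roundTo_of_mem_edge h hx hθ]
    split_ifs <;> simp

lemma convex_roundTo_fiber {u v : V} (huv : u ≠ v) {θ : ℝ} (hθ : θ ∈ Set.Ico (0 : ℝ) 1) :
    Convex ℝ {x | x ∈ edge u v ∧ roundTo θ x = u} := by
  rcases lt_or_gt_of_ne huv with h | h
  · have : {x | x ∈ edge u v ∧ roundTo θ x = u} = edge u v ∩ {x | θ < x u} := by
      ext x
      refine and_congr_right fun hx => ?_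
      rw [roundTo_of_mem_edge h hx hθ]
      simp [huv.symm]
    rw [this]
    exact (convex_segment _ _).inter
      ((convex_Ioi θ).linear_preimage (LinearMap.proj (R := ℝ) (φ := fun _ : V => ℝ) u))
  · have : {x | x ∈ edge u v ∧ roundTo θ x = u} = edge u v ∩ {x | x v ≤ θ} := by
      ext x
      refine and_congr_right fun hx => ?_
      rw [edge_comm] at hx
      rw [roundTo_of_mem_edge h hx hθ]
      simp [huv.symm]
    rw [this]
    exact (convex_segment _ _).inter
      ((convex_Iic θ).linear_preimage (LinearMap.proj (R := ℝ) (φ := fun _ : V => ℝ) v))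

/-- With `u < v`, the separating thresholds form the half-open interval between the `u`-coordinates
of the two points, and its length is their distance. -/
lemma thresholdMeasure_roundTo_ne {u v : V} (huv : u ≠ v) {x y : V → ℝ} (hx : x ∈ edge u v)
    (hy : y ∈ edge u v) :
    thresholdMeasure {θ : Threshold | roundTo θ x ≠ roundTo θ y} = edist x y := by
  wlog h : u < v generalizing u v
  · rw [edge_comm] at hx hy
    exact this huv.symm hx hy (lt_of_le_of_ne (not_lt.mp h) huv.symm)
  wlog hxy : x u ≤ y u generalizing x y
  · rw [edist_comm, ← this hy hx (le_of_not_ge hxy)]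
    simp only [ne_comm]
  have hset : {θ : Threshold | roundTo θ x ≠ roundTo θ y} =
      Subtype.val ⁻¹' Set.Ico (x u) (y u) := by
    ext θ
    simp only [Set.mem_ofPred_eq, Set.mem_preimage, Set.mem_Ico]
    rw [roundTo_of_mem_edge h hx θ.2, roundTo_of_mem_edge h hy θ.2]
    split_ifs with h1 h2 h2
    · simp [h1]
    · exact absurd (h1.trans_le hxy) h2
    · simp [huv.symm, h2, not_lt.mp h1]
    · simp [h2]
  rw [hset, thresholdMeasure_preimage,
    edist_of_mem_edge huv hx hy]
  rw [mem_edge_iff huv] at hx hy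
  rw [Set.inter_eq_left.mpr (Set.Ico_subset_Ico hx.1 (by linarith [hy.2.2.1, hy.2.1])),
    Real.volume_Ico, abs_sub_comm, abs_of_nonneg (by linarith)]

lemma measurableSet_roundTo_eq {u v : V} (huv : u ≠ v) {x : V → ℝ} (hx : x ∈ edge u v) (a : V) :
    MeasurableSet {θ : Threshold | roundTo θ x = a} := by
  wlog h : u < v generalizing u v
  · rw [edge_comm] at hx
    exact this huv.symm hx (lt_of_le_of_ne (not_lt.mp h) huv.symm)
  have hset : {θ : Threshold | roundTo θ x = a} =
      {θ : Threshold | (if (θ : ℝ) < x u then u else v) = a} := by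
    ext θ
    simp only [Set.mem_ofPred_eq]
    rw [roundTo_of_mem_edge h hx θ.2]
  rw [hset]
  let : MeasurableSpace V := ⊤
  have hm : Measurable fun θ : Threshold => if (θ : ℝ) < x u then u else v :=
    Measurable.ite (measurableSet_lt measurable_subtype_coe measurable_const)
      measurable_const measurable_const
  exact hm (MeasurableSpace.measurableSet_top (s := {a}))

/-- Rounding is right-continuous in the threshold because the intervals of constancy are closed on
the left. This serves the measurability of tree distances. -/
lemma eventually_roundTo_eq {u v : V} (huv : u ≠ v) {x : V → ℝ} (hx : x ∈ edge u v) {θ : ℝ}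
    (hθ : θ ∈ Set.Ico (0 : ℝ) 1) :
    ∀ᶠ θ' in nhdsWithin θ (Set.Ioi θ), roundTo θ' x = roundTo θ x := by
  wlog h : u < v generalizing u v
  · rw [edge_comm] at hx
    exact this huv.symm hx (lt_of_le_of_ne (not_lt.mp h) huv.symm)
  have h1 : ∀ᶠ θ' in nhdsWithin θ (Set.Ioi θ), θ' ∈ Set.Ico (0 : ℝ) 1 := by
    filter_upwards [self_mem_nhdsWithin, mem_nhdsWithin_of_mem_nhds (Iio_mem_nhds hθ.2)]
      with θ' h1 h2
    exact ⟨hθ.1.trans (le_of_lt h1), h2⟩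
  by_cases hlt : θ < x u
  · filter_upwards [h1, mem_nhdsWithin_of_mem_nhds (Iio_mem_nhds hlt)] with θ' h1 h2
    rw [roundTo_of_mem_edge h hx hθ, roundTo_of_mem_edge h hx h1, if_pos hlt,
      if_pos (Set.mem_Iio.mp h2)]
  · filter_upwards [h1, self_mem_nhdsWithin] with θ' h1 h2
    have : ¬ θ' < x u := fun h' => hlt (lt_trans h2 h')
    rw [roundTo_of_mem_edge h hx hθ, roundTo_of_mem_edge h hx h1, if_neg hlt, if_neg this]

end Rounding

/-- Intervals in `A` to the right of its non-interior points are pairwise disjoint, so there are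
only countably many such points and `A` is an open set plus a countable one. -/
lemma measurableSet_of_forall_mem_nhdsGT {A : Set ℝ} (hA : ∀ a ∈ A, A ∈ nhdsWithin a (Set.Ioi a)) :
    MeasurableSet A := by
  have h : ∀ a, ∃ b, a ∈ A → a < b ∧ Set.Ioo a b ⊆ A := by
    intro a
    by_cases ha : a ∈ A
    · obtain ⟨b, hb, hab⟩ := mem_nhdsGT_iff_exists_Ioo_subset.mp (hA a ha)
      exact ⟨b, fun _ => ⟨hb, hab⟩⟩
    · exact ⟨a, fun h => absurd h ha⟩
  choose b hb using h
  have hcount : (A \ interior A).Countable := by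
    refine Set.PairwiseDisjoint.countable_of_Ioo (y := b) ?_ fun a ha => (hb a ha.1).1
    have key : ∀ a ∈ A \ interior A, ∀ a' ∈ A \ interior A, a < a' →
        Disjoint (Set.Ioo a (b a)) (Set.Ioo a' (b a')) := by
      intro a ha a' ha' haa'
      refine Set.disjoint_left.mpr fun z hz hz' => ha'.2 ?_
      exact interior_maximal (hb a ha.1).2 isOpen_Ioo ⟨haa', hz'.1.trans hz.2⟩
    intro a ha a' ha' hne
    rcases lt_or_gt_of_ne hne with h | h
    exacts [key a ha a' ha' h, (key a' ha' a ha h).symm]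
  rw [← Set.sdiff_union_of_subset (interior_subset (s := A))]
  exact hcount.measurableSet.union isOpen_interior.measurableSet

/-! ### The random spanning tree of the complex -/

section RoundedTree

lemma measurable_edist {V : Type*} [Fintype V] {G : SimpleGraph V} (x y : complex G) :
    Measurable fun T : SpanningTree G => T.edist x y := by
  refine Measurable.mono (comap_measurable _) ?_ le_rfl
  exact le_iSup_of_le x (le_iSup_of_le y le_rfl)

variable {V : Type*} [Fintype V] [LinearOrder V] [Nonempty V] {G : SimpleGraph V}

/-- The spanning tree of the complex with underlying tree `T` in which each edge outside `T` is
cut at the threshold `θ`. -/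
noncomputable def roundedTree (T : GraphTree G) (θ : Threshold) : SpanningTree G where
  tree := T.1
  tree_le := T.2.1
  isTree := T.2.2
  half d := {x | x ∈ edge d.fst d.snd ∧ roundTo θ x = d.fst}
  vertex_mem_half d := ⟨vertex_mem_edge_left _ _, roundTo_vertex θ.2 _⟩
  half_connected d := ⟨⟨_, vertex_mem_edge_left _ _, roundTo_vertex θ.2 _⟩,
    (convex_roundTo_fiber d.adj.ne θ.2).isPreconnected⟩
  half_union d := by
    ext x
    constructor
    · rintro (h | h)
      · exact h.1
      · rw [edge_comm]; exact h.1
    · intro h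
      rcases roundTo_eq_or d.adj.ne h θ.2 with h1 | h1
      · exact Or.inl ⟨h, h1⟩
      · rw [edge_comm] at h
        exact Or.inr ⟨h, h1⟩
  half_disjoint d := Set.disjoint_left.mpr fun x h h' => d.adj.ne (h.2.symm.trans h'.2)

lemma exists_common_piece {T : GraphTree G} {θ θ' : Threshold} {x y : V → ℝ}
    (hx : ∀ u v, G.Adj u v → x ∈ edge u v → roundTo θ' x = roundTo θ x)
    (hy : ∀ u v, G.Adj u v → y ∈ edge u v → roundTo θ' y = roundTo θ y)
    (h : ∃ A ∈ (roundedTree T θ).pieces, x ∈ A ∧ y ∈ A) :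
    ∃ A ∈ (roundedTree T θ').pieces, x ∈ A ∧ y ∈ A := by
  obtain ⟨A, hA | ⟨d, rfl⟩, hxA, hyA⟩ := h
  · exact ⟨A, Or.inl hA, hxA, hyA⟩
  · exact ⟨_, Or.inr ⟨d, rfl⟩, ⟨hxA.1, (hx _ _ d.adj.1 hxA.1).trans hxA.2⟩,
      ⟨hyA.1, (hy _ _ d.adj.1 hyA.1).trans hyA.2⟩⟩

/-- A bound `d_T(x,y) < c` is witnessed by one finite chain. Slightly increasing the threshold
changes the rounding of none of its points, so the same chain remains admissible. -/
lemma measurable_edist_roundedTree (T : GraphTree G) (x y : complex G) :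
    Measurable fun θ => (roundedTree T θ).edist x y := by
  refine measurable_of_Iio fun c => ?_
  let A : Set ℝ := {t | ∃ h : t ∈ Set.Ico (0 : ℝ) 1, (roundedTree T ⟨t, h⟩).edist x y < c}
  have hA : MeasurableSet A := by
    refine measurableSet_of_forall_mem_nhdsGT ?_
    rintro t ⟨ht, hlt⟩
    obtain ⟨n, p, hp0, hpn, hp, hsum⟩ := chainEDist_lt_iff.mp hlt
    have h1 : ∀ᶠ t' in nhdsWithin t (Set.Ioi t), t' ∈ Set.Ico (0 : ℝ) 1 := by
      filter_upwards [self_mem_nhdsWithin, mem_nhdsWithin_of_mem_nhds (Iio_mem_nhds ht.2)]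
        with t' h1 h2
      exact ⟨ht.1.trans (le_of_lt h1), h2⟩
    have h2 : ∀ᶠ t' in nhdsWithin t (Set.Ioi t), ∀ i ∈ Finset.range (n + 1),
        ∀ u v, G.Adj u v → p i ∈ edge u v → roundTo t' (p i) = roundTo t (p i) := by
      rw [Filter.eventually_all_finset]
      intro i _
      by_cases hi : ∃ u v, G.Adj u v ∧ p i ∈ edge u v
      · obtain ⟨u, v, huv, hi⟩ := hi
        filter_upwards [eventually_roundTo_eq huv.ne hi ht] with t' h _ _ _ _
        exact h
      · exact Filter.Eventually.of_forall fun t' u v huv h => absurd ⟨u, v, huv, h⟩ hi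
    filter_upwards [h1, h2] with t' h1 h2
    refine ⟨h1, chainEDist_lt_iff.mpr ⟨n, p, hp0, hpn, fun i hi => ?_, hsum⟩⟩
    exact exists_common_piece (θ := ⟨t, ht⟩) (h2 i (by simp; omega))
      (h2 (i + 1) (by simp; omega)) (hp i hi)
  convert measurable_subtype_coe (p := (· ∈ Set.Ico (0 : ℝ) 1)) hA using 1
  ext θ
  exact ⟨fun h => ⟨θ.2, h⟩, fun h => h.2⟩

lemma measurable_roundedTree (T : GraphTree G) : Measurable (roundedTree T) := by
  rw [measurable_iff_comap_le, SpanningTree.instMeasurableSpace, MeasurableSpace.comap_iSup]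
  refine iSup_le fun x => ?_
  rw [MeasurableSpace.comap_iSup]
  refine iSup_le fun y => ?_
  rw [MeasurableSpace.comap_comp]
  exact (measurable_edist_roundedTree T x y).comap_le

lemma edist_roundedTree_le_of_roundTo_eq {T : GraphTree G} {θ : Threshold} {u v : V}
    (huv : G.Adj u v) {x y : complex G} (hx : (x : V → ℝ) ∈ edge u v)
    (hy : (y : V → ℝ) ∈ edge u v) (hxy : roundTo θ (x : V → ℝ) = roundTo θ (y : V → ℝ)) :
    (roundedTree T θ).edist x y ≤ edist (x : V → ℝ) y := by
  by_cases hT : T.1.Adj u v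
  · exact chainEDist_le_edist (Or.inl ⟨u, v, hT, rfl⟩) hx hy
  · wlog h : roundTo θ (x : V → ℝ) = u generalizing u v
    · refine this huv.symm (by rwa [edge_comm]) (by rwa [edge_comm]) (fun h => hT h.symm) ?_
      exact (roundTo_eq_or huv.ne hx θ.2).resolve_left h
    let d : (G \ T.1).Dart := ⟨(u, v), huv, hT⟩
    have hd : (roundedTree T θ).half d ∈ (roundedTree T θ).pieces := Or.inr ⟨d, rfl⟩
    exact chainEDist_le_edist hd (show _ ∧ _ from ⟨hx, h⟩) (show _ ∧ _ from ⟨hy, hxy.symm.trans h⟩)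

lemma edist_roundedTree_le (T : GraphTree G) (θ : Threshold) {u v : V}
    (huv : G.Adj u v) {x y : complex G} (hx : (x : V → ℝ) ∈ edge u v)
    (hy : (y : V → ℝ) ∈ edge u v) :
    (roundedTree T θ).edist x y ≤ edist (x : V → ℝ) y +
      {θ : Threshold | roundTo θ (x : V → ℝ) ≠ roundTo θ (y : V → ℝ)}.indicator
        (fun _ => (2 + T.1.dist u v : ℝ≥0∞)) θ := by
  by_cases hxy : roundTo θ (x : V → ℝ) = roundTo θ (y : V → ℝ)
  · exact (edist_roundedTree_le_of_roundTo_eq huv hx hy hxy).trans le_self_add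
  rw [Set.indicator_of_mem (show θ ∈ {θ : Threshold | roundTo θ (x : V → ℝ) ≠ roundTo θ
    (y : V → ℝ)} from hxy)]
  -- Separated points are joined through the vertices they round to: at most `1` at either end, and
  -- the tree path between.
  refine le_trans ?_ le_add_self
  have hr : ∀ z ∈ edge u v, vertex (roundTo θ z) ∈ edge u v := by
    intro z hz
    rcases roundTo_eq_or huv.ne hz θ.2 with h | h <;> rw [h]
    exacts [vertex_mem_edge_left _ _, vertex_mem_edge_right _ _]
  have hleft : (roundedTree T θ).edist x ⟨vertex (roundTo θ (x : V → ℝ)), Or.inl ⟨_, rfl⟩⟩ ≤ 1 :=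
    (edist_roundedTree_le_of_roundTo_eq huv hx (hr _ hx) (roundTo_vertex θ.2 _).symm).trans
      (edist_le_one_of_mem_edge huv.ne hx (hr _ hx))
  have hright : (roundedTree T θ).edist ⟨vertex (roundTo θ (y : V → ℝ)), Or.inl ⟨_, rfl⟩⟩ y ≤ 1 :=
    (edist_roundedTree_le_of_roundTo_eq huv (hr _ hy) hy (roundTo_vertex θ.2 _)).trans
      (edist_le_one_of_mem_edge huv.ne (hr _ hy) hy)
  have hmid : chainEDist (roundedTree T θ).pieces (vertex (roundTo θ (x : V → ℝ)))
      (vertex (roundTo θ (y : V → ℝ))) ≤ T.1.dist u v := by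
    refine (chainEDist_vertex_le_dist T.2.2.connected Set.subset_union_left _ _).trans ?_
    rcases roundTo_eq_or huv.ne hx θ.2 with h | h <;>
    rcases roundTo_eq_or huv.ne hy θ.2 with h' | h' <;> rw [h, h']
    · simp
    · rw [SimpleGraph.dist_comm]
    · simp
  refine (chainEDist_triangle _ (vertex (roundTo θ (y : V → ℝ))) _).trans ?_
  refine (add_le_add (chainEDist_triangle _ (vertex (roundTo θ (x : V → ℝ))) _) le_rfl).trans ?_
  refine (add_le_add (add_le_add hleft hmid) hright).trans ?_
  rw [add_right_comm, one_add_one_eq_two]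

/-- The distribution of the spanning tree of the complex with random underlying tree and
independent uniform threshold. -/
noncomputable def randomTree (p : GraphTree G → ℝ) : Measure (SpanningTree G) :=
  ∑ T, ENNReal.ofReal (p T) • thresholdMeasure.map (roundedTree T)

lemma isProbabilityMeasure_randomTree {p : GraphTree G → ℝ} (hp : ∀ T, 0 ≤ p T)
    (hp1 : ∑ T, p T = 1) : IsProbabilityMeasure (randomTree p) := by
  constructor
  have h : ∀ T : GraphTree G, IsProbabilityMeasure (thresholdMeasure.map (roundedTree T)) :=
    fun T => Measure.isProbabilityMeasure_map (measurable_roundedTree T).aemeasurable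
  simp only [randomTree, Measure.coe_finsetSum, Finset.sum_apply, Measure.smul_apply,
    measure_univ, smul_eq_mul, mul_one]
  rw [← ENNReal.ofReal_sum_of_nonneg fun T _ => hp T, hp1, ENNReal.ofReal_one]

lemma lintegral_min_edist_roundedTree_le (T : GraphTree G) {D N : ℕ} (hDN : D ≤ N) {u v : V}
    (huv : G.Adj u v) {x y : complex G} (hx : (x : V → ℝ) ∈ edge u v)
    (hy : (y : V → ℝ) ∈ edge u v) :
    ∫⁻ θ, min ((roundedTree T θ).edist x y) D ∂thresholdMeasure ≤
      (3 + ENNReal.ofReal (min (T.1.dist u v : ℝ) N)) * edist (x : V → ℝ) y := by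
  have hcast : (2 : ℝ≥0∞) + ENNReal.ofReal (min (T.1.dist u v : ℝ) N) =
      2 + (min (T.1.dist u v) N : ℕ) := by
    rw [← Nat.cast_min, ENNReal.ofReal_natCast]
  set S := {θ : Threshold | roundTo θ (x : V → ℝ) ≠ roundTo θ (y : V → ℝ)} with hS
  calc ∫⁻ θ, min ((roundedTree T θ).edist x y) D ∂thresholdMeasure
      ≤ ∫⁻ θ, (edist (x : V → ℝ) y + S.indicator
          (fun _ => 2 + ENNReal.ofReal (min (T.1.dist u v : ℝ) N)) θ) ∂thresholdMeasure := by
        refine lintegral_mono fun θ => ?_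
        have h := edist_roundedTree_le T θ huv hx hy
        by_cases hθ : θ ∈ S
        · rw [Set.indicator_of_mem hθ] at h ⊢
          rcases le_total (T.1.dist u v) N with hle | hle
          · rw [hcast, min_eq_left hle]
            exact (min_le_left _ _).trans h
          -- When the tree distance exceeds `N`, the truncation at `D ≤ N` pays for it.
          · rw [hcast, min_eq_right hle]
            refine (min_le_right _ _).trans ?_
            refine le_trans ?_ le_add_self
            exact (Nat.cast_le.mpr hDN).trans le_add_self
        · rw [Set.indicator_of_notMem hθ] at h ⊢
          exact (min_le_left _ _).trans h
    _ ≤ edist (x : V → ℝ) y + (2 + ENNReal.ofReal (min (T.1.dist u v : ℝ) N)) *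
          thresholdMeasure S := by
        rw [lintegral_add_left measurable_const, lintegral_const, measure_univ, mul_one]
        exact add_le_add le_rfl (lintegral_indicator_const_le _ _)
    _ = _ := by
        rw [hS, thresholdMeasure_roundTo_ne huv.ne hx hy]
        ring

lemma lintegral_randomTree (p : GraphTree G → ℝ) {f : SpanningTree G → ℝ≥0∞}
    (hf : Measurable f) : ∫⁻ T, f T ∂randomTree p =
      ∑ T, ENNReal.ofReal (p T) * ∫⁻ θ, f (roundedTree T θ) ∂thresholdMeasure := by
  rw [randomTree, lintegral_finsetSum_measure]
  refine Finset.sum_congr rfl fun T _ => ?_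
  rw [lintegral_smul_measure, lintegral_map hf (measurable_roundedTree T), smul_eq_mul]

lemma sum_ofReal_mul_ofReal_le {ι : Type*} [Fintype ι] {p c : ι → ℝ} {B : ℝ} (hp : ∀ i, 0 ≤ p i)
    (hc : ∀ i, 0 ≤ c i) (h : ∑ i, p i * c i ≤ B) :
    ∑ i, ENNReal.ofReal (p i) * ENNReal.ofReal (c i) ≤ ENNReal.ofReal B := by
  simp_rw [← ENNReal.ofReal_mul (hp _)]
  rw [← ENNReal.ofReal_sum_of_nonneg fun i _ => mul_nonneg (hp i) (hc i)]
  exact ENNReal.ofReal_le_ofReal h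

/-- Truncation preserves the triangle inequality, so the expected truncated distance is a semimetric
and only pairs on a common edge need to be estimated. -/
lemma lintegral_min_edist_randomTree_le {p : GraphTree G → ℝ} (hp : ∀ T, 0 ≤ p T)
    (hp1 : ∑ T, p T = 1) {D N : ℕ} (hDN : D ≤ N) {B : ℝ}
    (hB : ∀ u v, G.Adj u v → ∑ T : GraphTree G, p T * min (T.1.dist u v : ℝ) N ≤ B)
    (x y : complex G) :
    ∫⁻ T, min (T.edist x y) (D : ℝ≥0∞) ∂randomTree p ≤
      (3 + ENNReal.ofReal B) * complexEDist G x y := by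
  refine le_mul_chainEDist (S := complex G) (𝒜 := edges G)
    (ρ := fun x y => ∫⁻ T, min (T.edist x y) (D : ℝ≥0∞) ∂randomTree p)
    (fun A hA => edges_subset_complex hA) (by simp) (by finiteness) ?_ ?_ ?_ x y
  · intro x
    simp only [SpanningTree.edist, chainEDist_self]
    simp
  · intro x y z
    rw [← lintegral_add_left ((measurable_edist x y).min measurable_const)]
    refine lintegral_mono fun T => ?_
    have h : T.edist x z ≤ T.edist x y + T.edist y z := chainEDist_triangle _ _ _
    rcases le_total (T.edist x y) D with h1 | h1
    · rcases le_total (T.edist y z) D with h2 | h2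
      · rw [min_eq_left h1, min_eq_left h2]
        exact (min_le_left _ _).trans h
      · rw [min_eq_right h2]
        exact (min_le_right _ _).trans le_add_self
    · rw [min_eq_right h1]
      exact (min_le_right _ _).trans le_self_add
  · rintro A ⟨u, v, huv, rfl⟩ x y hx hy
    rw [lintegral_randomTree p ((measurable_edist x y).min measurable_const)]
    calc ∑ T, ENNReal.ofReal (p T) *
          ∫⁻ θ, min ((roundedTree T θ).edist x y) D ∂thresholdMeasure
        ≤ ∑ T : GraphTree G, ENNReal.ofReal (p T) *
          ((3 + ENNReal.ofReal (min (T.1.dist u v : ℝ) N)) * edist (x : V → ℝ) y) :=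
          Finset.sum_le_sum fun T _ => by
            gcongr
            exact lintegral_min_edist_roundedTree_le T hDN huv hx hy
      _ = (3 * ∑ T, ENNReal.ofReal (p T) + ∑ T : GraphTree G, ENNReal.ofReal (p T) *
          ENNReal.ofReal (min (T.1.dist u v : ℝ) N)) * edist (x : V → ℝ) y := by
          rw [Finset.mul_sum, ← Finset.sum_add_distrib, Finset.sum_mul]
          exact Finset.sum_congr rfl fun T _ => by ring
      _ ≤ _ := by
          gcongr
          · rw [← ENNReal.ofReal_sum_of_nonneg fun T _ => hp T, hp1, ENNReal.ofReal_one, mul_one]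
          · exact sum_ofReal_mul_ofReal_le hp (fun T => by positivity) (hB u v huv)

end RoundedTree

/-! ### Random parities and tree distance -/

section Signs

variable {V : Type*} [Fintype V]

open Classical in
/-- The edges of `T` that separate `v` from `r`. -/
noncomputable def separatingEdges (T : SimpleGraph V) (r v : V) : Finset (Sym2 V) :=
  {e | e ∈ T.edgeSet ∧ ¬ (T.deleteEdges {e}).Reachable r v}

-- Deleting any other edge leaves `a` and `b` adjacent, hence on the same side of the root; deleting
-- the bridge `ab` leaves the root connected to exactly one of them.
open Classical in
lemma symmDiff_separatingEdges_of_adj {T : SimpleGraph V} (hT : T.IsTree) (r : V) {a b : V}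
    (hab : T.Adj a b) :
    symmDiff (separatingEdges T r a) (separatingEdges T r b) = {s(a, b)} := by
  have hbridge := SimpleGraph.isAcyclic_iff_forall_adj_isBridge.mp hT.isAcyclic hab
  rw [SimpleGraph.isBridge_iff] at hbridge
  have hother : ∀ e, e ≠ s(a, b) → ((T.deleteEdges {e}).Reachable r a ↔
      (T.deleteEdges {e}).Reachable r b) := by
    intro e he
    have : (T.deleteEdges {e}).Adj a b := by
      rw [SimpleGraph.deleteEdges_adj]
      exact ⟨hab, fun h => he (Set.mem_singleton_iff.mp h).symm⟩
    exact ⟨fun h => h.trans this.reachable, fun h => h.trans this.symm.reachable⟩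
  have hself : (T.deleteEdges {s(a, b)}).Reachable r a ∨
      (T.deleteEdges {s(a, b)}).Reachable r b := by
    obtain ⟨p⟩ := hT.connected.preconnected a r
    suffices ∀ x y (p : T.Walk x y), ((T.deleteEdges {s(a, b)}).Reachable x a ∨
        (T.deleteEdges {s(a, b)}).Reachable x b) → ((T.deleteEdges {s(a, b)}).Reachable y a ∨
        (T.deleteEdges {s(a, b)}).Reachable y b) from
      this a r p (Or.inl (SimpleGraph.Reachable.refl _))
    intro x y p
    induction p with
    | nil => exact id
    | @cons x w y hxw _ ih =>
      intro h
      refine ih ?_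
      by_cases he : s(x, w) = s(a, b)
      · have : w = a ∨ w = b := by
          have hw : w ∈ s(a, b) := he ▸ Sym2.mem_mk_right x w
          exact Sym2.mem_iff.mp hw
        rcases this with rfl | rfl
        exacts [Or.inl (SimpleGraph.Reachable.refl _), Or.inr (SimpleGraph.Reachable.refl _)]
      · have : (T.deleteEdges {s(a, b)}).Adj w x := by
          rw [SimpleGraph.deleteEdges_adj]
          exact ⟨hxw.symm, fun h => he (Sym2.eq_swap.trans (Set.mem_singleton_iff.mp h))⟩
        exact h.imp this.reachable.trans this.reachable.trans
  ext e
  simp only [Finset.mem_symmDiff, separatingEdges, Finset.mem_filter, Finset.mem_univ, true_and,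
    Finset.mem_singleton]
  by_cases he : e = s(a, b)
  · subst he
    have hmem : s(a, b) ∈ T.edgeSet := hab
    by_cases ha : (T.deleteEdges {s(a, b)}).Reachable r a
    · have hb : ¬ (T.deleteEdges {s(a, b)}).Reachable r b := fun hb => hbridge (ha.symm.trans hb)
      simp [ha, hb, hmem]
    · have hb := hself.resolve_left ha
      simp [ha, hb, hmem]
  · have := hother e he
    simp only [he, iff_false]
    tauto

-- Symmetric differences telescope along the walk, and nothing cancels because a trail repeats no
-- edge.
open Classical in
lemma symmDiff_separatingEdges_of_isTrail {T : SimpleGraph V} (hT : T.IsTree) (r : V) {u v : V}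
    (p : T.Walk u v) (hp : p.IsTrail) :
    symmDiff (separatingEdges T r u) (separatingEdges T r v) = p.edges.toFinset := by
  induction p with
  | nil => simp
  | @cons u w v h p ih =>
    rw [SimpleGraph.Walk.isTrail_cons] at hp
    have htri : symmDiff (separatingEdges T r u) (separatingEdges T r v) =
        symmDiff (symmDiff (separatingEdges T r u) (separatingEdges T r w))
          (symmDiff (separatingEdges T r w) (separatingEdges T r v)) := by
      rw [symmDiff_assoc, symmDiff_symmDiff_cancel_left]
    rw [htri, symmDiff_separatingEdges_of_adj hT r h, ih hp.1, SimpleGraph.Walk.edges_cons,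
      List.toFinset_cons]
    ext e
    simp only [Finset.mem_symmDiff, Finset.mem_singleton, Finset.mem_insert, List.mem_toFinset]
    constructor
    · tauto
    · rintro (rfl | he)
      · exact Or.inl ⟨rfl, hp.2⟩
      · exact Or.inr ⟨he, fun h => hp.2 (h ▸ he)⟩

open Classical in
lemma card_symmDiff_separatingEdges {T : SimpleGraph V} (hT : T.IsTree) (r u v : V) :
    (symmDiff (separatingEdges T r u) (separatingEdges T r v)).card = T.dist u v := by
  obtain ⟨p, hp, hlen⟩ := hT.connected.exists_path_of_dist u v
  rw [symmDiff_separatingEdges_of_isTrail hT r p hp.isTrail,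
    List.toFinset_card_of_nodup hp.isTrail.edges_nodup, SimpleGraph.Walk.length_edges, hlen]

open Classical in
/-- The sign of `S` against the cut set `A`: the parity of `|A ∩ S|`. -/
noncomputable def paritySign {ι : Type*} (A S : Finset ι) : ℝ := ∏ e ∈ A, if e ∈ S then -1 else 1

lemma paritySign_eq_or {ι : Type*} (A S : Finset ι) : paritySign A S = 1 ∨ paritySign A S = -1 := by
  classical
  unfold paritySign
  induction A using Finset.induction_on with
  | empty => simp
  | insert a A ha ih =>
    rw [Finset.prod_insert ha]
    rcases ih with h | h <;> rw [h] <;> split_ifs <;> simp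

open Classical in
lemma paritySign_mul {ι : Type*} (A S S' : Finset ι) :
    paritySign A S * paritySign A S' = paritySign A (symmDiff S S') := by
  unfold paritySign
  rw [← Finset.prod_mul_distrib]
  refine Finset.prod_congr rfl fun e _ => ?_
  by_cases h : e ∈ S <;> by_cases h' : e ∈ S' <;> simp [Finset.mem_symmDiff, h, h']

open Classical in
lemma abs_paritySign_sub {ι : Type*} (A S S' : Finset ι) :
    |paritySign A S - paritySign A S'| = 1 - paritySign A (symmDiff S S') := by
  rw [← paritySign_mul]
  rcases paritySign_eq_or A S with h | h <;> rcases paritySign_eq_or A S' with h' | h' <;>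
    rw [h, h'] <;> norm_num

/-- The probability of the set `A` when its elements are chosen independently with
probability `q`. -/
noncomputable def bernoulliWeight {ι : Type*} [Fintype ι] (q : ℝ) (A : Finset ι) : ℝ :=
  q ^ A.card * (1 - q) ^ (Fintype.card ι - A.card)

/-- The parity is a product of independent factors: each element of `S` contributes the mean `1 -
2q`, every other element `1`. -/
lemma sum_bernoulliWeight_mul_paritySign {ι : Type*} [Fintype ι] (q : ℝ) (S : Finset ι) :
    ∑ A, bernoulliWeight q A * paritySign A S = (1 - 2 * q) ^ S.card := by
  classical
  have h := Finset.prod_add (fun e => q * if e ∈ S then (-1 : ℝ) else 1) (fun _ => 1 - q)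
    (Finset.univ : Finset ι)
  have h1 : ∏ e : ι, ((q * if e ∈ S then (-1 : ℝ) else 1) + (1 - q)) = (1 - 2 * q) ^ S.card := by
    rw [← Finset.prod_const, ← Finset.prod_subset (Finset.subset_univ S)]
    · refine Finset.prod_congr rfl fun e he => ?_
      rw [if_pos he]; ring
    · intro e _ he
      rw [if_neg he]; ring
  rw [← h1, h, Finset.powerset_univ]
  refine Finset.sum_congr rfl fun A _ => ?_
  rw [Finset.prod_mul_distrib, Finset.prod_const, Finset.prod_const, bernoulliWeight,
    Finset.card_sdiff_of_subset (Finset.subset_univ _), Finset.card_univ, paritySign]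
  ring

lemma bernoulliWeight_nonneg {ι : Type*} [Fintype ι] {q : ℝ} (h0 : 0 ≤ q) (h1 : q ≤ 1)
    (A : Finset ι) : 0 ≤ bernoulliWeight q A :=
  mul_nonneg (pow_nonneg h0 _) (pow_nonneg (by linarith) _)

lemma sum_bernoulliWeight {ι : Type*} [Fintype ι] (q : ℝ) :
    ∑ A : Finset ι, bernoulliWeight q A = 1 := by
  simpa [paritySign] using sum_bernoulliWeight_mul_paritySign (ι := ι) q ∅

/-- The sum over random cut sets of the sign differences is a bounded function of the
tree distance. -/
lemma sum_bernoulliWeight_mul_abs_sub {T : SimpleGraph V} (hT : T.IsTree) (q : ℝ) (r u v : V) :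
    ∑ A, bernoulliWeight q A * |paritySign A (separatingEdges T r u) -
      paritySign A (separatingEdges T r v)| = 1 - (1 - 2 * q) ^ T.dist u v := by
  classical
  simp only [abs_paritySign_sub, mul_sub, mul_one, Finset.sum_sub_distrib]
  rw [sum_bernoulliWeight, sum_bernoulliWeight_mul_paritySign,
    ← card_symmDiff_separatingEdges hT r u v]
  congr!

end Signs

lemma one_sub_pow_le_min {N : ℕ} (hN : 0 < N) (d : ℕ) :
    1 - (1 - 1 / (N : ℝ)) ^ d ≤ min (d : ℝ) N / N := by
  have hN' : (1 : ℝ) ≤ N := by exact_mod_cast hN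
  have h1 : 1 / (N : ℝ) ≤ 1 := by rw [div_le_one (by linarith)]; exact hN'
  have h0 : 0 ≤ 1 / (N : ℝ) := by positivity
  have hb := one_add_mul_le_pow (a := -(1 / (N : ℝ))) (by linarith) d
  have hp : 0 ≤ (1 - 1 / (N : ℝ)) ^ d := pow_nonneg (by linarith) _
  rw [← min_div_div_right (by linarith), div_self (by linarith)]
  refine le_min ?_ (by linarith)
  rw [← sub_eq_add_neg] at hb
  have : (d : ℝ) / N = d * (1 / N) := by ring
  linarith

/-- With `t = 1/N`, Bernoulli's inequality and `(1 - t)^m (1 + t)^m ≤ 1` give `(1 - t)^m ≤ 1/(1 +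
mt)`, which is at most `1 - mt/2` since `mt ≤ 1`. -/
lemma div_le_one_sub_pow {N m d : ℕ} (hN : 0 < N) (hm : m ≤ N) (hd : m ≤ d) :
    (m : ℝ) / (2 * N) ≤ 1 - (1 - 1 / (N : ℝ)) ^ d := by
  have hN' : (1 : ℝ) ≤ N := by exact_mod_cast hN
  have hmN : (m : ℝ) ≤ N := by exact_mod_cast hm
  set t := 1 / (N : ℝ) with ht
  have h1 : t ≤ 1 := by rw [ht, div_le_one (by linarith)]; exact hN'
  have h0 : 0 ≤ t := by positivity
  have hmt : (m : ℝ) * t ≤ 1 := by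
    rw [ht, mul_one_div, div_le_one (by linarith)]; exact hmN
  have hmt0 : 0 ≤ (m : ℝ) * t := by positivity
  have h2 : (1 - t) ^ d ≤ (1 - t) ^ m := pow_le_pow_of_le_one (by linarith) (by linarith) hd
  have h3 : (1 - t) ^ m * (1 + t) ^ m ≤ 1 := by
    rw [← mul_pow]
    exact pow_le_one₀ (by nlinarith) (by nlinarith)
  have h4 := one_add_mul_le_pow (a := t) (by linarith) m
  have h5 : 0 ≤ (1 - t) ^ m := pow_nonneg (by linarith) _
  have h6 : (1 - t) ^ m * (1 + m * t) ≤ 1 := (mul_le_mul_of_nonneg_left h4 h5).trans h3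
  have h7 : (1 - t) ^ m ≤ 1 - m * t / 2 := by nlinarith
  have h8 : (m : ℝ) / (2 * N) = m * t / 2 := by rw [ht]; field_simp
  linarith

/-! ### Embedding the complex into `L1` -/

section Embedding

/-- A finite mixture of bounded functions of a uniform threshold is realized isometrically
in `L_1`. -/
lemma exists_map_L1 {I X : Type*} [Fintype I] [Nonempty I] {w : I → ℝ} (hw : ∀ i, 0 ≤ w i)
    (hw1 : ∑ i, w i = 1) (F : X → I → Threshold → ℝ) (hF : ∀ x i, Measurable (F x i))
    (hF1 : ∀ x i θ, |F x i θ| ≤ 1) :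
    ∃ f : X → L1, ∀ x y, edist (f x) (f y) =
      ∑ i, ENNReal.ofReal (w i) *
        ∫⁻ θ, ENNReal.ofReal |F x i θ - F y i θ| ∂thresholdMeasure := by
  let : MeasurableSpace I := ⊤
  have : DiscreteMeasurableSpace I := ⟨fun _ => trivial⟩
  have : StandardBorelSpace Threshold := measurableSet_Ico.standardBorel
  have : Nonempty Threshold := ⟨⟨0, by simp⟩⟩
  let P : Measure (I × Threshold) :=
    ∑ i, ENNReal.ofReal (w i) • thresholdMeasure.map (Prod.mk i)
  have hP : IsProbabilityMeasure P := by
    constructor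
    have h : ∀ i : I, IsProbabilityMeasure (thresholdMeasure.map (Prod.mk i)) :=
      fun i => Measure.isProbabilityMeasure_map measurable_prodMk_left.aemeasurable
    simp only [P, Measure.coe_finsetSum, Finset.sum_apply, Measure.smul_apply,
      measure_univ, smul_eq_mul, mul_one]
    rw [← ENNReal.ofReal_sum_of_nonneg fun i _ => hw i, hw1, ENNReal.ofReal_one]
  -- A probability measure on a standard Borel space is an image of Lebesgue measure on the unit
  -- interval; pulling back along `h` preserves the `L1` distances.
  obtain ⟨h, hmeas, hmap⟩ := P.exists_measurable_map_eq
  have hFm : ∀ x, Measurable fun z : I × Threshold => F x z.1 z.2 := fun x =>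
    measurable_from_prod_countable_right fun i => hF x i
  have hmem : ∀ x, MemLp (fun ω => F x (h ω).1 (h ω).2) 1 (volume : Measure unitInterval) :=
    fun x => MemLp.of_bound ((hFm x).comp hmeas).aestronglyMeasurable 1
      (Filter.Eventually.of_forall fun ω => hF1 x _ _)
  refine ⟨fun x => (hmem x).toLp, fun x y => ?_⟩
  have hm : Measurable fun z : I × Threshold => ENNReal.ofReal |F x z.1 z.2 - F y z.1 z.2| :=
    ((hFm x).sub (hFm y)).norm.ennreal_ofReal
  rw [Lp.edist_toLp_toLp, eLpNorm_one_eq_lintegral_enorm]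
  have h1 : ∀ ω, ‖((fun ω => F x (h ω).1 (h ω).2) - fun ω => F y (h ω).1 (h ω).2) ω‖ₑ =
      (fun z : I × Threshold => ENNReal.ofReal |F x z.1 z.2 - F y z.1 z.2|) (h ω) := by
    intro ω
    rw [← ofReal_norm, Real.norm_eq_abs, Pi.sub_apply]
  simp_rw [h1]
  rw [← lintegral_map hm hmeas, hmap, lintegral_finsetSum_measure]
  refine Finset.sum_congr rfl fun i _ => ?_
  rw [lintegral_smul_measure, lintegral_map hm measurable_prodMk_left, smul_eq_mul]

variable {V : Type*} [Fintype V]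

/-- A random spanning tree with small expected truncated distances on the edges provides an
embedding of the vertices into a finite-dimensional space `ℓ_1`. -/
lemma exists_vertex_embedding [Nonempty V] {G : SimpleGraph V} {p : GraphTree G → ℝ}
    (hp : ∀ T, 0 ≤ p T) (hp1 : ∑ T, p T = 1) {N : ℕ} (hN : 0 < N)
    (hGN : ∀ u v, G.dist u v ≤ N) {B : ℝ}
    (hB : ∀ u v, G.Adj u v → ∑ T : GraphTree G, p T * min (T.1.dist u v : ℝ) N ≤ B) :
    ∃ (w : GraphTree G × Finset (Sym2 V) → ℝ) (g : GraphTree G × Finset (Sym2 V) → V → ℝ),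
      (∀ i, 0 ≤ w i) ∧ ∑ i, w i = 1 ∧ (∀ i v, |g i v| ≤ 1) ∧
      (∀ u v, (G.dist u v : ℝ) / (2 * N) ≤ ∑ i, w i * |g i u - g i v|) ∧
      ∀ u v, G.Adj u v → ∑ i, w i * |g i u - g i v| ≤ B / N := by
  obtain ⟨r⟩ := ‹Nonempty V›
  have hN' : (1 : ℝ) ≤ N := by exact_mod_cast hN
  -- This makes the mean sign `1 - 2q` of one tree edge equal to `1 - 1/N`.
  set q : ℝ := 1 / (2 * N) with hq
  have hq0 : 0 ≤ q := by positivity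
  have hq1 : q ≤ 1 := by rw [hq, div_le_one (by linarith)]; linarith
  have hq2 : 1 - 2 * q = 1 - 1 / (N : ℝ) := by rw [hq]; field_simp
  have hsum : ∀ u v, ∑ i : GraphTree G × Finset (Sym2 V), p i.1 * bernoulliWeight q i.2 *
      |paritySign i.2 (separatingEdges i.1.1 r u) - paritySign i.2 (separatingEdges i.1.1 r v)| =
      ∑ T : GraphTree G, p T * (1 - (1 - 1 / (N : ℝ)) ^ T.1.dist u v) := by
    intro u v
    rw [Fintype.sum_prod_type]
    refine Finset.sum_congr rfl fun T _ => ?_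
    rw [← hq2, ← sum_bernoulliWeight_mul_abs_sub T.2.2 q r u v, Finset.mul_sum]
    exact Finset.sum_congr rfl fun A _ => mul_assoc _ _ _
  refine ⟨fun i => p i.1 * bernoulliWeight q i.2,
    fun i v => paritySign i.2 (separatingEdges i.1.1 r v),
    fun i => mul_nonneg (hp _) (bernoulliWeight_nonneg hq0 hq1 _), ?_, ?_, ?_, ?_⟩
  · rw [Fintype.sum_prod_type]
    simp only [← Finset.mul_sum, sum_bernoulliWeight, mul_one, hp1]
  · intro i v
    rcases paritySign_eq_or i.2 (separatingEdges i.1.1 r v) with h | h <;> simp [h]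
  · intro u v
    rw [hsum]
    calc (G.dist u v : ℝ) / (2 * N) = ∑ T : GraphTree G, p T * ((G.dist u v : ℝ) / (2 * N)) := by
          rw [← Finset.sum_mul, hp1, one_mul]
      _ ≤ _ := by
          refine Finset.sum_le_sum fun T _ => mul_le_mul_of_nonneg_left ?_ (hp T)
          exact div_le_one_sub_pow hN (hGN u v)
            ((T.2.2.connected.preconnected u v).dist_anti T.2.1)
  · intro u v huv
    rw [hsum, le_div_iff₀ (by linarith)]
    refine le_trans ?_ (hB u v huv)
    rw [Finset.sum_mul]
    refine Finset.sum_le_sum fun T _ => ?_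
    rw [mul_assoc]
    refine mul_le_mul_of_nonneg_left ?_ (hp T)
    rw [← le_div_iff₀ (by linarith)]
    exact one_sub_pow_le_min hN _

lemma exists_mem_edge {V : Type*} [Nontrivial V] {G : SimpleGraph V} (hG : G.Connected)
    (x : complex G) : ∃ u v, G.Adj u v ∧ (x : V → ℝ) ∈ edge u v := by
  obtain ⟨x, ⟨v, rfl⟩ | h⟩ := x
  · obtain ⟨w, hw⟩ := hG.preconnected.exists_adj_of_nontrivial v
    exact ⟨v, w, hw, vertex_mem_edge_left _ _⟩
  · exact h

variable [LinearOrder V]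

lemma measurable_comp_roundTo [Nontrivial V] {G : SimpleGraph V} (hG : G.Connected)
    {β : Type*} [MeasurableSpace β] (F : V → V → β) (x y : complex G) :
    Measurable fun θ : Threshold => F (roundTo θ (x : V → ℝ)) (roundTo θ (y : V → ℝ)) := by
  let : MeasurableSpace V := ⊤
  have : DiscreteMeasurableSpace V := ⟨fun _ => trivial⟩
  have h : ∀ x : complex G, Measurable fun θ : Threshold => roundTo θ (x : V → ℝ) := by
    intro x
    obtain ⟨u, v, huv, hx⟩ := exists_mem_edge hG x
    exact measurable_to_countable' fun a => measurableSet_roundTo_eq huv.ne hx a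
  exact (Measurable.of_discrete (f := fun z : V × V => F z.1 z.2)).comp ((h x).prodMk (h y))

lemma measure_le_lintegral_of_one_le {Ω : Type*} [MeasurableSpace Ω] {μ : Measure Ω}
    {f : Ω → ℝ≥0∞} (hf : Measurable f) {S : Set Ω} (h : ∀ ω ∈ S, 1 ≤ f ω) :
    μ S ≤ ∫⁻ ω, f ω ∂μ := by
  refine (measure_mono h).trans ?_
  have := mul_meas_ge_le_lintegral (μ := μ) hf 1
  rwa [one_mul] at this

/-- Rounding contracts the distances of the complex by a bounded factor at most. -/
lemma complexEDist_le_lintegral_dist [Nontrivial V] {G : SimpleGraph V} (hG : G.Connected)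
    (x y : complex G) : complexEDist G x y ≤
      3 * ∫⁻ θ : Threshold, (G.dist (roundTo θ (x : V → ℝ)) (roundTo θ (y : V → ℝ)) : ℝ≥0∞)
        ∂thresholdMeasure := by
  have hmeas : Measurable fun θ : Threshold =>
      (G.dist (roundTo θ (x : V → ℝ)) (roundTo θ (y : V → ℝ)) : ℝ≥0∞) :=
    measurable_comp_roundTo hG (fun u v => (G.dist u v : ℝ≥0∞)) x y
  have hone : ∀ u v, u ≠ v → (1 : ℝ≥0∞) ≤ G.dist u v := fun u v h => by
    exact_mod_cast hG.pos_dist_of_ne h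
  obtain ⟨u, v, huv, hx⟩ := exists_mem_edge hG x
  obtain ⟨u', v', huv', hy⟩ := exists_mem_edge hG y
  have hpiece : ∀ {a b} {z z' : V → ℝ}, G.Adj a b → z ∈ edge a b → z' ∈ edge a b →
      chainEDist (edges G) z z' ≤ edist z z' := fun hab hz hz' =>
    chainEDist_le_edist (show _ ∈ edges G from ⟨_, _, hab, rfl⟩) hz hz'
  set J := ∫⁻ θ : Threshold, (G.dist (roundTo θ (x : V → ℝ)) (roundTo θ (y : V → ℝ)) : ℝ≥0∞)
    ∂thresholdMeasure with hJ
  -- If the edges of `x` and `y` share an end `u` but differ, then `x` and `y` round to distinct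
  -- vertices as soon as either fails to round to `u`; hence the distance from each to `u` is at
  -- most `J`.
  have hshare : ∀ u v v', G.Adj u v → G.Adj u v' → (x : V → ℝ) ∈ edge u v →
      (y : V → ℝ) ∈ edge u v' → complexEDist G x y ≤ 3 * J := by
    intro u v v' huv huv' hx hy
    by_cases hv : v = v'
    · subst hv
      calc complexEDist G x y ≤ edist (x : V → ℝ) y := hpiece huv hx hy
        _ ≤ J := by
          rw [← thresholdMeasure_roundTo_ne huv.ne hx hy]
          exact measure_le_lintegral_of_one_le hmeas fun θ hθ => hone _ _ hθ
        _ ≤ 3 * J := le_mul_of_one_le_left zero_le (by norm_num)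
    · have h1 : edist (x : V → ℝ) (vertex u) ≤ J := by
        rw [← thresholdMeasure_roundTo_ne huv.ne hx (vertex_mem_edge_left _ _)]
        refine measure_le_lintegral_of_one_le hmeas fun θ hθ => hone _ _ ?_
        rw [Set.mem_ofPred_eq, roundTo_vertex θ.2] at hθ
        rw [(roundTo_eq_or huv.ne hx θ.2).resolve_left hθ]
        rcases roundTo_eq_or huv'.ne hy θ.2 with h | h <;> rw [h]
        exacts [huv.ne', hv]
      have h2 : edist (vertex u) (y : V → ℝ) ≤ J := by
        rw [← thresholdMeasure_roundTo_ne huv'.ne (vertex_mem_edge_left _ _) hy]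
        refine measure_le_lintegral_of_one_le hmeas fun θ hθ => hone _ _ ?_
        rw [Set.mem_ofPred_eq, roundTo_vertex θ.2] at hθ
        rw [(roundTo_eq_or huv'.ne hy θ.2).resolve_left hθ.symm]
        rcases roundTo_eq_or huv.ne hx θ.2 with h | h <;> rw [h]
        exacts [huv'.ne, hv]
      refine (chainEDist_triangle _ (vertex u) _).trans ?_
      refine (add_le_add
        (hpiece huv hx (vertex_mem_edge_left _ _))
        (hpiece huv' (vertex_mem_edge_left _ _) hy)).trans ?_
      refine (add_le_add h1 h2).trans ?_
      rw [← two_mul]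
      gcongr
      norm_num
  by_cases h1 : u = u'
  · subst h1; exact hshare _ _ _ huv huv' hx hy
  by_cases h2 : u = v'
  · subst h2; exact hshare _ _ _ huv huv'.symm hx (by rwa [edge_comm])
  by_cases h3 : v = u'
  · subst h3; exact hshare _ _ _ huv.symm huv' (by rwa [edge_comm]) hy
  by_cases h4 : v = v'
  · subst h4; exact hshare _ _ _ huv.symm huv'.symm (by rwa [edge_comm]) (by rwa [edge_comm])
  -- On disjoint edges the rounded vertices always differ, so their distance is at least `1` and
  -- absorbs the two unit moves to and from them, whence the factor `3`.
  have hpt : ∀ θ : Threshold, complexEDist G x y ≤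
      3 * (G.dist (roundTo θ (x : V → ℝ)) (roundTo θ (y : V → ℝ)) : ℝ≥0∞) := by
    intro θ
    have hend : ∀ {a b} {z : V → ℝ}, G.Adj a b → z ∈ edge a b →
        chainEDist (edges G) z (vertex (roundTo θ z)) ≤ 1 ∧
        chainEDist (edges G) (vertex (roundTo θ z)) z ≤ 1 := by
      intro a b z hab hz
      have hr : vertex (roundTo θ z) ∈ edge a b := by
        rcases roundTo_eq_or hab.ne hz θ.2 with h | h <;> rw [h]
        exacts [vertex_mem_edge_left _ _, vertex_mem_edge_right _ _]
      exact ⟨(hpiece hab hz hr).trans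
          (edist_le_one_of_mem_edge hab.ne hz hr),
        (hpiece hab hr hz).trans
          (edist_le_one_of_mem_edge hab.ne hr hz)⟩
    have hne : roundTo θ (x : V → ℝ) ≠ roundTo θ (y : V → ℝ) := by
      rcases roundTo_eq_or huv.ne hx θ.2 with h | h <;>
      rcases roundTo_eq_or huv'.ne hy θ.2 with h' | h' <;> rw [h, h'] <;> assumption
    have h5 := hone _ _ hne
    refine (chainEDist_triangle _ (vertex (roundTo θ (y : V → ℝ))) _).trans ?_
    refine (add_le_add (chainEDist_triangle _ (vertex (roundTo θ (x : V → ℝ))) _) le_rfl).trans ?_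
    refine (add_le_add (add_le_add (hend huv hx).1
      (chainEDist_vertex_le_dist hG subset_rfl _ _)) (hend huv' hy).2).trans ?_
    calc _ ≤ _ := add_le_add (add_le_add h5 le_rfl) h5
      _ = _ := by ring
  calc complexEDist G x y = ∫⁻ _ : Threshold, complexEDist G x y ∂thresholdMeasure := by simp
    _ ≤ _ := lintegral_mono hpt
    _ = 3 * J := lintegral_const_mul _ hmeas

lemma distortion_le [Nontrivial V] {G : SimpleGraph V} (hG : G.Connected)
    {p : GraphTree G → ℝ} (hp : ∀ T, 0 ≤ p T) (hp1 : ∑ T, p T = 1) {N : ℕ} (hN : 0 < N)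
    (hGN : ∀ u v, G.dist u v ≤ N) {B : ℝ} (hB1 : 1 ≤ B)
    (hB : ∀ u v, G.Adj u v → ∑ T : GraphTree G, p T * min (T.1.dist u v : ℝ) N ≤ B) :
    distortion (complexEDist G) L1 ≤ ENNReal.ofReal (6 * B) := by
  obtain ⟨w, g, hw, hw1, hg, hlow, hupp⟩ := exists_vertex_embedding hp hp1 hN hGN hB
  have hN' : (1 : ℝ) ≤ N := by exact_mod_cast hN
  have : Nonempty (GraphTree G × Finset (Sym2 V)) := by
    obtain ⟨T, hT⟩ := hG.exists_isTree_le
    exact ⟨⟨T, hT⟩, ∅⟩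
  obtain ⟨f, hf⟩ := exists_map_L1 hw hw1
    (fun (x : complex G) i (θ : Threshold) => g i (roundTo θ (x : V → ℝ)))
    (fun x i => measurable_comp_roundTo hG (fun u _ => g i u) x x) (fun x i θ => hg i _)
  have hf' : ∀ x y, edist (f x) (f y) = ∫⁻ θ : Threshold, ENNReal.ofReal
      (∑ i, w i * |g i (roundTo θ (x : V → ℝ)) - g i (roundTo θ (y : V → ℝ))|)
      ∂thresholdMeasure := by
    intro x y
    rw [hf]
    have hm : ∀ i, Measurable fun θ : Threshold => ENNReal.ofReal
        |g i (roundTo θ (x : V → ℝ)) - g i (roundTo θ (y : V → ℝ))| := fun i =>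
      measurable_comp_roundTo hG (fun u v => ENNReal.ofReal |g i u - g i v|) x y
    simp_rw [← lintegral_const_mul _ (hm _)]
    rw [← lintegral_finsetSum _ fun i _ => (hm i).const_mul _]
    refine lintegral_congr fun θ => ?_
    rw [ENNReal.ofReal_sum_of_nonneg fun i _ => mul_nonneg (hw i) (abs_nonneg _)]
    exact Finset.sum_congr rfl fun i _ => (ENNReal.ofReal_mul (hw i)).symm
  have hlower : ∀ x y, ENNReal.ofReal (1 / (6 * N)) * complexEDist G x y ≤
      edist (f x) (f y) := by
    intro x y
    have hmeas : Measurable fun θ : Threshold =>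
        (G.dist (roundTo θ (x : V → ℝ)) (roundTo θ (y : V → ℝ)) : ℝ≥0∞) :=
      measurable_comp_roundTo hG (fun u v => (G.dist u v : ℝ≥0∞)) x y
    refine (mul_le_mul_right (complexEDist_le_lintegral_dist hG x y) _).trans ?_
    rw [hf', ← mul_assoc, ← lintegral_const_mul _ hmeas]
    refine lintegral_mono fun θ => ?_
    have h3 : (3 : ℝ≥0∞) = ENNReal.ofReal 3 := by simp
    rw [h3, ← ENNReal.ofReal_natCast, ← ENNReal.ofReal_mul (by positivity),
      ← ENNReal.ofReal_mul (by positivity)]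
    refine ENNReal.ofReal_le_ofReal (le_trans (le_of_eq ?_) (hlow _ _))
    field_simp
    ring
  have hupper : ∀ x y, edist (f x) (f y) ≤ ENNReal.ofReal (B / N) * complexEDist G x y := by
    refine le_mul_chainEDist (S := complex G) (ρ := fun x y => edist (f x) (f y))
      (fun A hA => edges_subset_complex hA) ?_ ENNReal.ofReal_ne_top
      (fun x => edist_self _) (fun x y z => edist_triangle _ _ _) ?_
    · rw [Ne, ENNReal.ofReal_eq_zero, not_le]; positivity
    · rintro A ⟨u, v, huv, rfl⟩ x y hx hy
      rw [hf', ← thresholdMeasure_roundTo_ne huv.ne hx hy]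
      refine le_trans (lintegral_mono fun θ => ?_) (lintegral_indicator_const_le _ _)
      by_cases hθ : roundTo θ (x : V → ℝ) = roundTo θ (y : V → ℝ)
      · simp [hθ]
      · rw [Set.indicator_of_mem (show θ ∈ {θ : Threshold | roundTo θ (x : V → ℝ) ≠ roundTo θ
          (y : V → ℝ)} from hθ)]
        refine ENNReal.ofReal_le_ofReal (hupp _ _ ?_)
        rcases roundTo_eq_or huv.ne hx θ.2 with h | h <;>
        rcases roundTo_eq_or huv.ne hy θ.2 with h' | h' <;> rw [h, h'] at hθ ⊢
        exacts [absurd rfl hθ, huv, huv.symm, absurd rfl hθ]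
  have hBs : ENNReal.ofReal (6 * B) * ENNReal.ofReal (1 / (6 * N)) = ENNReal.ofReal (B / N) := by
    rw [← ENNReal.ofReal_mul (by linarith)]
    congr 1
    field_simp
  -- The lower scale `1/(6N)` combines the factor `1/(2N)` on vertices with the rounding loss `3`;
  -- against the upper Lipschitz constant `B/N` it leaves `6B`.
  refine iInf_le_of_le (Real.toNNReal (6 * B)) (iInf_le_of_le ?_ (iInf_le_of_le ?_ le_rfl))
  · rw [Real.one_le_toNNReal]; linarith
  · refine ⟨Real.toNNReal (1 / (6 * N)), Real.toNNReal_pos.mpr (by positivity), f, fun x y =>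
      ⟨hlower x y, ?_⟩⟩
    change _ ≤ ENNReal.ofReal (6 * B) * ENNReal.ofReal (1 / (6 * N)) * _
    rw [hBs]
    exact hupper x y

end Embedding

lemma distortion_le_one_of_subsingleton {X : Type*} [Subsingleton X] {d : X → X → ℝ≥0∞}
    (hd : ∀ x, d x x = 0) : distortion d L1 ≤ 1 := by
  refine iInf_le_of_le 1 (iInf_le_of_le le_rfl (iInf_le_of_le ?_ (by simp)))
  refine ⟨1, one_pos, fun _ => 0, fun x y => ?_⟩
  rw [Subsingleton.elim y x, hd]
  simp

end GraphComplex

/-! ### Assembly of the constants -/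

open GraphComplex in
theorem theorem6p5 :
    ∃ C : ℝ≥0, ∀ (V : Type*) [Fintype V] (G : SimpleGraph V) (δ : ℝ),
      0 < δ → δ < 1 → G.Connected → GraphComplex.IsSparse G δ →
      (∃ μ : Measure (GraphComplex.SpanningTree G), IsProbabilityMeasure μ ∧
        ∀ x y : GraphComplex.complex G,
          ∫⁻ T, min (T.edist x y) (G.diam : ℝ≥0∞) ∂μ
            ≤ C * (1 + ENNReal.ofReal δ * (G.diam : ℝ≥0∞)) * GraphComplex.complexEDist G x y) ∧
      GraphComplex.distortion (GraphComplex.complexEDist G) GraphComplex.L1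
        ≤ C * (1 + ENNReal.ofReal δ * (G.diam : ℝ≥0∞)) := by
  -- The embedding dictates the constant: `6(2 + 2δ(diam + 1)) ≤ 24(1 + δ diam)` because `δ < 1`.
  -- The tree bound only needs `3 + 2 + 2δ(diam + 1)`.
  refine ⟨24, fun V _ G δ hδ hδ1 hG hs => ?_⟩
  let : LinearOrder V := LinearOrder.lift' (Fintype.equivFin V) (Fintype.equivFin V).injective
  have : Nonempty V := hG.nonempty
  -- Truncating at `diam + 1` instead of `diam` keeps the level positive, as the embedding requires,
  -- also for a single vertex.
  obtain ⟨p, hp, hp1, hB⟩ := exists_random_tree hδ.le hG hs (G.diam + 1)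
  have hbound : 1 + ENNReal.ofReal δ * (G.diam : ℝ≥0∞) = ENNReal.ofReal (1 + δ * G.diam) := by
    rw [ENNReal.ofReal_add zero_le_one (by positivity), ENNReal.ofReal_one,
      ENNReal.ofReal_mul hδ.le, ENNReal.ofReal_natCast]
  have hC : ((24 : ℝ≥0) : ℝ≥0∞) = ENNReal.ofReal 24 := by simp
  have hδD : 0 ≤ δ * G.diam := by positivity
  rw [hbound, hC, ← ENNReal.ofReal_mul (by norm_num)]
  refine ⟨⟨randomTree p, isProbabilityMeasure_randomTree hp hp1, fun x y => ?_⟩, ?_⟩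
  · refine (lintegral_min_edist_randomTree_le hp hp1 (Nat.le_succ _) hB x y).trans ?_
    gcongr
    have h3 : (3 : ℝ≥0∞) = ENNReal.ofReal 3 := by simp
    rw [h3, ← ENNReal.ofReal_add (by norm_num) (by positivity)]
    refine ENNReal.ofReal_le_ofReal ?_
    push_cast
    nlinarith
  · rcases subsingleton_or_nontrivial V with hV | hV
    · have hsub : Subsingleton (complex G) := by
        refine ⟨fun x y => Subtype.ext ?_⟩
        have hvert : ∀ x : complex G, ∃ v, (x : V → ℝ) = vertex v := by
          rintro ⟨x, h | ⟨u, v, huv, _⟩⟩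
          exacts [h, absurd (Subsingleton.elim u v) huv.ne]
        obtain ⟨u, hu⟩ := hvert x
        obtain ⟨v, hv⟩ := hvert y
        rw [hu, hv, Subsingleton.elim u v]
      have h1 : distortion (complexEDist G) L1 ≤ 1 :=
        distortion_le_one_of_subsingleton fun x => chainEDist_self (x : V → ℝ)
      refine h1.trans ?_
      rw [ENNReal.one_le_ofReal]
      linarith
    · have hGN : ∀ u v, G.dist u v ≤ G.diam + 1 := fun u v =>
        (SimpleGraph.dist_le_diam (SimpleGraph.connected_iff_ediam_ne_top.mp hG)).trans
          (Nat.le_succ _)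
      refine (distortion_le hG hp hp1 (Nat.succ_pos _) hGN ?_ hB).trans
        (ENNReal.ofReal_le_ofReal ?_)
      · have : 0 ≤ δ * ((G.diam + 1 : ℕ) : ℝ) := by positivity
        linarith
      · push_cast
        nlinarith
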